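/- **Theorem 1 (Convergence of mini-batch training with MSE).** *Setting.* Let $G$ be an arbitrary simple undirected graph on $n$ nodes, let $n_{\text{train}}$ of its nodes be training nodes, let $b\le n_{\text{train}}$ be the batch size and $\beta\in\mathbb N$ the fan-out size. In each iteration $t=0,1,2,\dots$ a batch $B_t$ of $b$ training nodes is drawn uniformly, and every node $i$ uniformly draws a set $N_t(i)$ of $\min(\beta,\deg i)$ of its neighbours; all draws are independent. For a set $S$ of target nodes and sampled neighbourhoods $N$, let $A\in\{0,1\}^{S\times n}$ have entries $A_{ij}=1$ iff $j\in N(i)$, let $D^{\text{in}},D^{\text{out}}$ be its diagonal row-sum and column-sum matrices, and let $\tilde a_i$, $i\in S$, be the rows of $\tilde A=(D^{\text{in}}+I)^{-1/2}(A+I)(D^{\text{out}}+I)^{-1/2}$, that is, $\tilde A_{ij}=(A_{ij}+\mathbf 1_{i=j})/\sqrt{(D^{\text{in}}_{ii}+1)(D^{\text{out}}_{jj}+1)}$. The one-layer GNN with parameters $W\in\mathbb R^{h\times r}$ ($h\ge2$ hidden units, feature size $r\ge 2$) has output $\sigma(\tilde a_iXW^\top)$ at node $i$, with $\sigma(x)=\sqrt2\max(x,0)$.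 The targets are the outputs of a ground truth $W^*\in\mathbb R^{h\times r}$ all of whose rows have Euclidean norm $1$. The expected MSE loss is $$L_S(W,N)=\frac1{|S|}\sum_{i\in S}\mathbb E_X\Big[\tfrac12\big\|\sigma(\tilde a_iXW^\top)-\sigma(\tilde a_iX{W^*}^\top)\big\|_2^2\Big],$$ where the rows of $X\in\mathbb R^{n\times r}$ are i.i.d. $N(0,I_r)$. Write $L_{\text{train}}$ for $L_S$ with $S$ the whole training set. Mini-batch SGD is $W_{t+1}=W_t-\eta_t\nabla_W L_{B_t}(W_t,N_t)$, where the rows of $W_0$ are i.i.d. $N(0,\kappa^2I_r)$, $\kappa>0$, and $W_0$ is independent of the sampling. The learning rates satisfy $$c\,\frac{\beta^3}{n_{\text{train}}b^2}\le\eta_t\le\frac{b}{6\pi\beta\, n_{\text{train}}}\qquad\text{for all }t,$$ with a constant $c\in(0,\frac1{6\pi}]$ (this range is non-empty under the fan-out condition below). *Claim.* Let $C_1,C_2\in(0,1)$ and $\delta\in(0,1)$. There is a constant $C>0$, depending only on $r,\kappa,c,C_1,C_2,\delta$, such that the following holds for all $n$, $G$, training sets, $h\ge2$, $b$, $\beta$,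 $W^*$, $(\eta_t)$ as above and all $\epsilon\in(0,1)$. If $$C_1\le\beta\le C_2\,b^{3/4},$$ then there is a deterministic $$T_0\le C\,n_{\text{train}}\,h^2\,b^{5/2}\,\beta^{-1/2}\,\epsilon^{-1}\log\!\big(h^2\epsilon^{-1}\big)$$ such that, with probability at least $1-\delta h^{-2}$, for all $T\ge T_0$ the training loss $L_{\text{train}}(W_T,N_T)$ over all training nodes with the sampled neighbourhoods, and also the mini-batch loss $L_{B_T}(W_T,N_T)$, are at most $\epsilon$. -/

import Mathlib

open MeasureTheory ProbabilityTheory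
open scoped NNReal Matrix Gradient

noncomputable section

namespace MiniBatchGNN

/-- Parameter matrices `W ∈ ℝ^{h × r}`, viewed as `h` rows in Euclidean space `ℝ^r`, with the
Frobenius norm and inner product. -/
abbrev Params (h r : ℕ) : Type := PiLp 2 fun _ : Fin h => EuclideanSpace ℝ (Fin r)

/-- The random choices of one training iteration on a graph with `n` nodes: the batch of target
nodes, and for every node the set of its sampled neighbours. -/
structure Sample (n : ℕ) where
  batch : Finset (Fin n)
  nbrs : Fin n → Finset (Fin n)

instance (n : ℕ) : MeasurableSpace (Sample n) := ⊤

/-- The admissible samples for batch size `b` and fan-out size `β`: the batch consists of `b`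
training nodes, and every node keeps `β` of its neighbours (all of them, if it has fewer). The
uniform distribution on this finite set is uniform batch sampling together with independent uniform
neighbour sampling without replacement. -/
def samples {n : ℕ} (G : SimpleGraph (Fin n)) (train : Finset (Fin n)) (b β : ℕ) :
    Set (Sample n) :=
  {s | s.batch ⊆ train ∧ s.batch.card = b ∧
    ∀ i, (s.nbrs i : Set (Fin n)) ⊆ G.neighborSet i ∧
      (s.nbrs i).card = min β (G.neighborSet i).ncard}

/-- Number of messages that node `i` receives, when it aggregates from the nodes in `N i`. -/
def inDeg {n : ℕ} (N : Fin n → Finset (Fin n)) (i : Fin n) : ℕ := (N i).card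

/-- Number of messages that node `j` sends to the target nodes in `S`. -/
def outDeg {n : ℕ} (S : Finset (Fin n)) (N : Fin n → Finset (Fin n)) (j : Fin n) : ℕ :=
  (S.filter fun i => j ∈ N i).card

/-- The entry `(i, j)` (row `i ∈ S`) of the normalized adjacency matrix with self-loops
`(D_in + I)^{-1/2} (A + I) (D_out + I)^{-1/2}`, where `A` has the rows `i ∈ S`, the columns
`1, …, n` and the entries `A i j = 1` if `j ∈ N i` and `0` otherwise. -/
def normAdj {n : ℕ} (S : Finset (Fin n)) (N : Fin n → Finset (Fin n)) (i j : Fin n) : ℝ :=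
  ((if j ∈ N i then 1 else 0) + (if i = j then 1 else 0)) /
    (√((inDeg N i : ℝ) + 1) * √((outDeg S N j : ℝ) + 1))

/-- The rescaled ReLU activation `σ(x) = √2 max(x, 0)`. -/
def relu (x : ℝ) : ℝ := √2 * max x 0

/-- The output `σ(a X Wᵀ) ∈ ℝ^h` of the one-layer GNN, for the aggregation row `a`. -/
def gnnOutput {n h r : ℕ} (a : Fin n → ℝ) (X : Matrix (Fin n) (Fin r) ℝ) (W : Params h r)
    (j : Fin h) : ℝ :=
  relu ((a ᵥ* X) ⬝ᵥ (fun k => W j k))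

/-- The squared loss of one node, with the targets produced by the ground truth `Wstar`. -/
def nodeLoss {n h r : ℕ} (a : Fin n → ℝ) (X : Matrix (Fin n) (Fin r) ℝ) (Wstar W : Params h r) :
    ℝ :=
  1 / 2 * ∑ j, (gnnOutput a X W j - gnnOutput a X Wstar j) ^ 2

/-- The law of the feature matrix: the rows are i.i.d. `N(0, I_r)`. -/
def featureLaw (n r : ℕ) : Measure (Fin n → Fin r → ℝ) :=
  Measure.pi fun _ => Measure.pi fun _ => gaussianReal 0 1

/-- The law of the Gaussian initialization: the rows are i.i.d. `N(0, κ² I_r)`. -/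
def initLaw (h r : ℕ) (κ : ℝ≥0) : Measure (Params h r) :=
  (Measure.pi fun _ : Fin h => Measure.pi fun _ : Fin r => gaussianReal 0 (κ ^ 2)).map
    fun M => WithLp.toLp 2 fun j => WithLp.toLp 2 (M j)

/-- The expected (over the Gaussian features) MSE loss, averaged over the nodes in `S`, of the
one-layer GNN whose nodes aggregate from their sampled neighbours `N`. -/
def expectedRisk {n h r : ℕ} (S : Finset (Fin n)) (N : Fin n → Finset (Fin n))
    (Wstar W : Params h r) : ℝ :=
  1 / (S.card : ℝ) *
    ∑ i ∈ S, ∫ X, nodeLoss (normAdj S N i) (Matrix.of X) Wstar W ∂featureLaw n r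

/-- Mini-batch SGD with learning rates `η`, samples `s` and initial value `W₀`: every step uses the
gradient of the expected MSE loss of the current batch with the currently sampled neighbours. -/
def sgd {n h r : ℕ} (η : ℕ → ℝ) (s : ℕ → Sample n) (Wstar W₀ : Params h r) : ℕ → Params h r
  | 0 => W₀
  | t + 1 => sgd η s Wstar W₀ t -
      η t • ∇ (expectedRisk (s t).batch (s t).nbrs Wstar) (sgd η s Wstar W₀ t)

end MiniBatchGNN

end

/-! Averaging over Gaussian features removes the graph from the loss. The aggregated feature of node
`i` is Gaussian with covariance `‖ã_i‖² I_r`, and ReLU is positively homogeneous, so the risk equals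
the scalar `aggScale` times a sum of single-neuron losses (`expectedRisk_eq`). A batch and its
sampled neighbourhoods therefore only rescale the step size, to `γ = η * aggScale`, and the hidden
units decouple. Degree counting gives `1/(β+1)² ≤ aggScale ≤ 1`, hence `g ≤ γ ≤ 1` with `g = cβ/(4
n_train b²)` (`effective_step_bounds`).

The loss of one neuron has an arc-cosine closed form (`neuronLoss_eq`), whose gradient stays in the
plane of `w` and its target `v`. With `x = ⟨v, w⟩` and `y` the distance of `w` from the line `ℝv`,
SGD becomes the planar recursion `IsNeuronPath`. The ratio `x / y` never decreases
(`monotone_ratio`), so the drift of `x` stays above its positive initial value. This forces first `x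
≥ 0`, then `x ≥ 1/4`, and from there `|x - 1| + 8y` contracts geometrically
(`IsNeuronPath.dist_sq_le`).

This convergence holds for every admissible sample sequence. The failure probability comes only from
the initialization: a row may be too long, or too close to the line through its target
(`le_initLaw_generic`). The admissible scales are powers of `h`, so they cost only a factor
`log(h²/ε)` in time. -/

noncomputable section

namespace MiniBatchGNN

/-! ### The planar Gaussian integral behind the arc-cosine kernel. -/

section GaussianIntegral

/-- The angular part of `E[max(s, 0) max(x s + y t, 0)]` for independent standard Gaussians. -/
lemma integral_max_cos_mul_max (x : ℝ) {y : ℝ} (hy : 0 < y) :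
    ∫ α in Set.Ioo (-Real.pi) Real.pi,
        max (Real.cos α) 0 * max (x * Real.cos α + y * Real.sin α) 0 =
      (y + (Real.pi / 2 + Real.arctan (x / y)) * x) / 2 := by
  set τ := Real.arctan (-(x / y)) with hτ
  have h1 := Real.neg_pi_div_two_lt_arctan (-(x / y))
  have h2 := Real.arctan_lt_pi_div_two (-(x / y))
  have hpi := Real.pi_pos
  -- In this form the sign of the linear factor is the sign of `α - τ`, so the integrand is
  -- supported on `(τ, π/2]`.
  have htan : ∀ α ∈ Set.Ioo (-(Real.pi / 2)) (Real.pi / 2),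
      x * Real.cos α + y * Real.sin α = Real.cos α * y * (Real.tan α - Real.tan τ) := by
    intro α hα
    have hc := Real.cos_pos_of_mem_Ioo hα
    rw [hτ, Real.tan_arctan, Real.tan_eq_sin_div_cos]
    field_simp
    ring
  have hsub : Set.Ioc τ (Real.pi / 2) ⊆ Set.Ioo (-Real.pi) Real.pi := by
    intro α hα
    exact ⟨by linarith [hα.1], by linarith [hα.2]⟩
  rw [setIntegral_eq_of_subset_of_forall_sdiff_eq_zero measurableSet_Ioo hsub]
  · have hcongr : ∫ α in Set.Ioc τ (Real.pi / 2),
        max (Real.cos α) 0 * max (x * Real.cos α + y * Real.sin α) 0 =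
        ∫ α in Set.Ioc τ (Real.pi / 2), Real.cos α * (x * Real.cos α + y * Real.sin α) := by
      refine setIntegral_congr_fun measurableSet_Ioc fun α hα => ?_
      have hc : 0 ≤ Real.cos α :=
        Real.cos_nonneg_of_mem_Icc ⟨by linarith [hα.1], by linarith [hα.2]⟩
      have hs : 0 ≤ x * Real.cos α + y * Real.sin α := by
        rcases hα.2.lt_or_eq with h | h
        · rw [htan α ⟨by linarith [hα.1], h⟩]
          have := Real.tan_lt_tan_of_lt_of_lt_pi_div_two h1 h hα.1
          have := sub_pos.2 this
          positivity
        · rw [h]; simp [hy.le]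
      simp only [max_eq_left hc, max_eq_left hs]
    rw [hcongr, ← intervalIntegral.integral_of_le (by linarith)]
    have hder : ∀ α ∈ Set.uIcc τ (Real.pi / 2), HasDerivAt
        (fun α => x * (α / 2 + Real.sin α * Real.cos α / 2) + y * (Real.sin α ^ 2 / 2))
        (Real.cos α * (x * Real.cos α + y * Real.sin α)) α := by
      intro α _
      have := ((((hasDerivAt_id α).div_const 2).add
        (((Real.hasDerivAt_sin α).mul (Real.hasDerivAt_cos α)).div_const 2)).const_mul x).add
        ((((Real.hasDerivAt_sin α).pow 2).div_const 2).const_mul y)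
      refine this.congr_deriv ?_
      have := Real.sin_sq_add_cos_sq α
      norm_num
      linear_combination (-x / 2) * this
    rw [intervalIntegral.integral_eq_sub_of_hasDerivAt hder
      (Continuous.intervalIntegrable (by fun_prop) _ _)]
    have hs : x * (Real.sin τ * Real.cos τ) + y * Real.sin τ ^ 2 = 0 := by
      have := htan τ ⟨h1, h2⟩
      simp only [sub_self, mul_zero] at this
      linear_combination Real.sin τ * this
    have : τ = - Real.arctan (x / y) := by rw [hτ, Real.arctan_neg]
    simp only [Real.sin_pi_div_two, Real.cos_pi_div_two]
    linear_combination -(1 / 2) * hs - x / 2 * this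
  · intro α hα
    have hα' : ¬ (τ < α ∧ α ≤ Real.pi / 2) := hα.2
    rcases lt_or_ge (Real.pi / 2) α with h | h
    · have : Real.cos α ≤ 0 :=
        Real.cos_nonpos_of_pi_div_two_le_of_le h.le (by linarith [hα.1.2])
      simp [max_eq_right this]
    rcases le_or_gt α (-(Real.pi / 2)) with h' | h'
    · have : Real.cos α ≤ 0 := by
        rw [← Real.cos_neg]
        exact Real.cos_nonpos_of_pi_div_two_le_of_le (by linarith) (by linarith [hα.1.1])
      simp [max_eq_right this]
    · have hle : α ≤ τ := by
        by_contra hlt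
        exact hα' ⟨not_le.1 hlt, h⟩
      have hα2 : α < Real.pi / 2 := hle.trans_lt h2
      have hc := Real.cos_pos_of_mem_Ioo ⟨h', hα2⟩
      have ht : Real.tan α ≤ Real.tan τ := by
        rcases hle.lt_or_eq with hlt | heq
        · exact (Real.tan_lt_tan_of_lt_of_lt_pi_div_two h' h2 hlt).le
        · rw [heq]
      have : x * Real.cos α + y * Real.sin α ≤ 0 := by
        rw [htan α ⟨h', hα2⟩]
        exact mul_nonpos_of_nonneg_of_nonpos (by positivity) (by linarith)
      simp [max_eq_right this]

/-- The radial factor: one power of `ρ` from the polar Jacobian and one from each of the two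
homogeneous factors. -/
lemma integral_pow_three_mul_exp_neg_sq_div_two :
    ∫ ρ in Set.Ioi (0 : ℝ), ρ ^ 3 * Real.exp (-ρ ^ 2 / 2) = 2 := by
  have h := integral_rpow_mul_exp_neg_mul_rpow (p := 2) (q := 3) (b := 1 / 2)
    (by norm_num) (by norm_num) (by norm_num)
  have hG : Real.Gamma ((3 + 1) / 2) = 1 := by
    rw [show ((3 : ℝ) + 1) / 2 = 1 + 1 by norm_num, Real.Gamma_add_one one_ne_zero,
      Real.Gamma_one, mul_one]
  have h4 : ((1 : ℝ) / 2) ^ (-((3 : ℝ) + 1) / 2) = 4 := by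
    rw [show (-((3 : ℝ) + 1) / 2) = ((-2 : ℤ) : ℝ) by norm_num, Real.rpow_intCast]
    norm_num
  rw [hG, h4] at h
  have h2 : (4 : ℝ) * (1 / 2) * 1 = 2 := by norm_num
  rw [h2] at h
  refine (setIntegral_congr_fun measurableSet_Ioi fun ρ _ => ?_).trans h
  have e1 : ρ ^ (3 : ℝ) = ρ ^ 3 := by exact_mod_cast Real.rpow_natCast ρ 3
  have e2 : ρ ^ (2 : ℝ) = ρ ^ 2 := by exact_mod_cast Real.rpow_natCast ρ 2
  simp only [e1, e2]
  congr 2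
  ring

/-- Both factors are positively homogeneous of degree one, so in polar coordinates the integral
splits into a radial and an angular part. -/
lemma integral_gaussian_max_mul_max (x : ℝ) {y : ℝ} (hy : 0 < y) :
    ∫ p : ℝ × ℝ, max p.1 0 * max (x * p.1 + y * p.2) 0
        ∂((gaussianReal 0 1).prod (gaussianReal 0 1)) =
      (y + (Real.pi / 2 + Real.arctan (x / y)) * x) / (2 * Real.pi) := by
  have hd : (gaussianReal 0 1).prod (gaussianReal 0 1) = (volume : Measure (ℝ × ℝ)).withDensity
      (fun z => gaussianPDF 0 1 z.1 * gaussianPDF 0 1 z.2) := by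
    rw [gaussianReal_of_var_ne_zero 0 one_ne_zero,
      prod_withDensity (measurable_gaussianPDF 0 1) (measurable_gaussianPDF 0 1)]
    rfl
  have hm : Measurable (fun z : ℝ × ℝ => gaussianPDF 0 1 z.1 * gaussianPDF 0 1 z.2) :=
    ((measurable_gaussianPDF 0 1).comp measurable_fst).mul
      ((measurable_gaussianPDF 0 1).comp measurable_snd)
  rw [hd, integral_withDensity_eq_integral_toReal_smul hm
    (Filter.Eventually.of_forall fun z =>
      ENNReal.mul_lt_top gaussianPDF_lt_top gaussianPDF_lt_top),
    ← integral_comp_polarCoord_symm, polarCoord_target]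
  have hcongr : ∀ p ∈ Set.Ioi (0 : ℝ) ×ˢ Set.Ioo (-Real.pi) Real.pi,
      (p.1 • ((gaussianPDF 0 1 (polarCoord.symm p).1 * gaussianPDF 0 1 (polarCoord.symm p).2).toReal
        • (max (polarCoord.symm p).1 0 *
          max (x * (polarCoord.symm p).1 + y * (polarCoord.symm p).2) 0)) : ℝ) =
      (p.1 ^ 3 * Real.exp (-p.1 ^ 2 / 2)) * ((1 / (2 * Real.pi)) *
        (max (Real.cos p.2) 0 * max (x * Real.cos p.2 + y * Real.sin p.2) 0)) := by
    rintro ⟨ρ, α⟩ ⟨hρ, -⟩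
    have hρ' : 0 < ρ := hρ
    have e1 : max (ρ * Real.cos α) 0 = ρ * max (Real.cos α) 0 := by
      rw [mul_max_of_nonneg _ _ hρ'.le, mul_zero]
    have e2 : max (x * (ρ * Real.cos α) + y * (ρ * Real.sin α)) 0 =
        ρ * max (x * Real.cos α + y * Real.sin α) 0 := by
      rw [mul_max_of_nonneg _ _ hρ'.le, mul_zero]
      congr 1
      ring
    have e3 : Real.exp (-ρ ^ 2 / 2) = Real.exp (-(ρ * Real.cos α) ^ 2 / 2) *
        Real.exp (-(ρ * Real.sin α) ^ 2 / 2) := by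
      rw [← Real.exp_add]
      congr 1
      linear_combination (ρ ^ 2 / 2) * Real.sin_sq_add_cos_sq α
    have e4 : (√(2 * Real.pi))⁻¹ * (√(2 * Real.pi))⁻¹ = 1 / (2 * Real.pi) := by
      rw [← mul_inv, Real.mul_self_sqrt (by positivity), one_div]
    simp only [polarCoord_symm_apply, ENNReal.toReal_mul, toReal_gaussianPDF, gaussianPDFReal,
      smul_eq_mul, e1, e2, e3, sub_zero, NNReal.coe_one, mul_one]
    rw [← e4]
    ring
  rw [setIntegral_congr_fun (measurableSet_Ioi.prod measurableSet_Ioo) hcongr,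
    Measure.volume_eq_prod, setIntegral_prod_mul (fun ρ : ℝ => ρ ^ 3 * Real.exp (-ρ ^ 2 / 2))
      (fun α : ℝ => (1 / (2 * Real.pi)) *
        (max (Real.cos α) 0 * max (x * Real.cos α + y * Real.sin α) 0)), integral_const_mul,
    integral_max_cos_mul_max x hy, integral_pow_three_mul_exp_neg_sq_div_two]
  field_simp

end GaussianIntegral

/-! ### Linear images of standard Gaussian vectors. -/

section Projections

variable {n r : ℕ}

/-- Aggregating the standard Gaussian features with weights `a` gives a centered Gaussian vector
with covariance matrix `‖a‖² I_r`. -/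
lemma map_featureLaw_vecMul (a : Fin n → ℝ) :
    (featureLaw n r).map (fun X => WithLp.toLp 2 (a ᵥ* Matrix.of X)) =
      (stdGaussian (EuclideanSpace ℝ (Fin r))).map (fun z => √(∑ i, a i ^ 2) • z) := by
  have hmeas : Measurable (fun X : Fin n → Fin r → ℝ =>
      (WithLp.toLp 2 (a ᵥ* Matrix.of X) : EuclideanSpace ℝ (Fin r))) := by
    refine (WithLp.measurable_toLp 2 _).comp (measurable_pi_lambda _ fun k => ?_)
    simp only [Matrix.vecMul, dotProduct, Matrix.of_apply]
    fun_prop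
  have : IsProbabilityMeasure (featureLaw n r) := by unfold featureLaw; infer_instance
  have hp := Measure.isProbabilityMeasure_map (μ := featureLaw n r) hmeas.aemeasurable
  apply Measure.ext_of_charFun
  ext t
  rw [charFun_map_smul, charFun_stdGaussian, charFun_apply,
    integral_map hmeas.aemeasurable (by fun_prop)]
  have hrow : ∀ i, ∫ x : Fin r → ℝ, Complex.exp
      (inner ℝ (WithLp.toLp 2 x : EuclideanSpace ℝ (Fin r)) (a i • t) * Complex.I)
        ∂(Measure.pi fun _ => gaussianReal 0 1) = Complex.exp (-‖a i • t‖ ^ 2 / 2) := by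
    intro i
    rw [← charFun_stdGaussian, ← map_pi_eq_stdGaussian, charFun_apply,
      integral_map (by fun_prop) (by fun_prop)]
  -- The rows are independent, so the characteristic function at `t` is a product in which row `i`
  -- is evaluated at `a i • t`.
  have hsplit : ∀ X : Fin n → Fin r → ℝ, Complex.exp
      (inner ℝ (WithLp.toLp 2 (a ᵥ* Matrix.of X) : EuclideanSpace ℝ (Fin r)) t * Complex.I) =
      ∏ i, Complex.exp
        (inner ℝ (WithLp.toLp 2 (X i) : EuclideanSpace ℝ (Fin r)) (a i • t) * Complex.I) := by
    intro X
    rw [← Complex.exp_sum, ← Finset.sum_mul, ← Complex.ofReal_sum]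
    congr 3
    simp only [PiLp.inner_apply, Matrix.vecMul, dotProduct, Matrix.of_apply,
      RCLike.inner_apply, conj_trivial, PiLp.smul_apply, smul_eq_mul, Finset.mul_sum]
    rw [Finset.sum_comm]
    exact Finset.sum_congr rfl fun i _ => Finset.sum_congr rfl fun k _ => by ring
  simp_rw [hsplit, featureLaw]
  rw [integral_fintype_prod_eq_prod (f := fun i (x : Fin r → ℝ) => Complex.exp
      (inner ℝ (WithLp.toLp 2 x : EuclideanSpace ℝ (Fin r)) (a i • t) * Complex.I))]
  simp_rw [hrow]
  rw [← Complex.exp_sum]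
  congr 1
  rw [norm_smul, Real.norm_of_nonneg (Real.sqrt_nonneg _), ← Complex.ofReal_pow, mul_pow,
    Real.sq_sqrt (Finset.sum_nonneg fun i _ => sq_nonneg _)]
  simp only [norm_smul, mul_pow, Complex.ofReal_mul, Complex.ofReal_pow, Real.norm_eq_abs,
    Complex.ofReal_sum, Finset.sum_mul]
  rw [← Finset.sum_neg_distrib, Finset.sum_div]
  refine Finset.sum_congr rfl fun i _ => ?_
  rw [← Complex.ofReal_pow, sq_abs, Complex.ofReal_pow]

variable {E : Type*} [NormedAddCommGroup E] [InnerProductSpace ℝ E] [FiniteDimensional ℝ E]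
  [MeasurableSpace E] [BorelSpace E]

lemma memLp_inner_stdGaussian (w : E) : MemLp (fun z => inner ℝ w z) 2 (stdGaussian E) :=
  (IsGaussian.memLp_two_id (μ := stdGaussian E)).const_inner w

lemma variance_inner_stdGaussian (w : E) :
    Var[fun z => inner ℝ w z; stdGaussian E] = ‖w‖ ^ 2 := by
  have := variance_dual_stdGaussian (innerSL ℝ w)
  rwa [innerSL_apply_norm] at this

lemma integral_inner_stdGaussian (w : E) : ∫ z, inner ℝ w z ∂(stdGaussian E) = 0 :=
  integral_strongDual_stdGaussian (innerSL ℝ w)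

lemma integral_sq_inner_stdGaussian (w : E) :
    ∫ z, (inner ℝ w z) ^ 2 ∂(stdGaussian E) = ‖w‖ ^ 2 := by
  rw [← variance_inner_stdGaussian,
    variance_of_integral_eq_zero (memLp_inner_stdGaussian w).aemeasurable
      (integral_inner_stdGaussian w)]

lemma map_inner_stdGaussian (w : E) :
    (stdGaussian E).map (fun z => inner ℝ w z) = gaussianReal 0 (‖w‖₊ ^ 2) := by
  have hG : HasGaussianLaw (fun z : E => inner ℝ w z) (stdGaussian E) :=
    (IsGaussian.hasGaussianLaw_id (μ := stdGaussian E)).map_fun (innerSL ℝ w)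
  rw [hG.map_eq_gaussianReal, integral_inner_stdGaussian, variance_inner_stdGaussian]
  congr 1
  ext
  simp

/-- Jointly Gaussian and uncorrelated coordinates are independent. This reduces expectations in
dimension `r` to the plane. -/
lemma map_inner_prod_stdGaussian {u v : E} (hu : ‖u‖ = 1) (hv : ‖v‖ = 1) (huv : inner ℝ u v = 0) :
    (stdGaussian E).map (fun z => (inner ℝ u z, inner ℝ v z)) =
      (gaussianReal 0 1).prod (gaussianReal 0 1) := by
  have hG : HasGaussianLaw (fun z : E => (inner ℝ u z, inner ℝ v z)) (stdGaussian E) :=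
    (IsGaussian.hasGaussianLaw_id (μ := stdGaussian E)).map_fun
      ((innerSL ℝ u).prod (innerSL ℝ v))
  have hcov : cov[fun z => inner ℝ u z, fun z => inner ℝ v z; stdGaussian E] = 0 := by
    rw [← covarianceBilin_apply_eq_cov IsGaussian.memLp_two_id, covarianceBilin_stdGaussian]
    exact huv
  have hind := hG.indepFun_of_covariance_eq_zero hcov
  rw [(indepFun_iff_map_prod_eq_prod_map_map (by fun_prop) (by fun_prop)).1 hind,
    map_inner_stdGaussian, map_inner_stdGaussian]
  have h1 : ‖u‖₊ = 1 := by ext; simpa using hu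
  have h2 : ‖v‖₊ = 1 := by ext; simpa using hv
  simp [h1, h2]

end Projections

/-! ### Homogeneity and Lipschitz bounds for the activation. -/

lemma relu_sq (s : ℝ) : relu s ^ 2 = 2 * max s 0 ^ 2 := by
  rw [relu, mul_pow, Real.sq_sqrt (by norm_num)]

lemma relu_mul_relu (s t : ℝ) : relu s * relu t = 2 * (max t 0 * max s 0) := by
  rw [relu, relu, mul_mul_mul_comm, Real.mul_self_sqrt (by norm_num), mul_comm (max s 0)]

lemma relu_mul_of_nonneg {c : ℝ} (hc : 0 ≤ c) (s : ℝ) : relu (c * s) = c * relu s := by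
  rw [relu, relu, mul_left_comm, mul_max_of_nonneg _ _ hc, mul_zero]

lemma continuous_relu : Continuous relu := by unfold relu; fun_prop

lemma relu_sub_relu_sq_le (s t : ℝ) : (relu s - relu t) ^ 2 ≤ 2 * (s - t) ^ 2 := by
  rw [relu, relu, ← mul_sub, mul_pow, Real.sq_sqrt (by norm_num)]
  have : |max s 0 - max t 0| ≤ |s - t| := abs_max_sub_max_le_abs s t 0
  have := sq_le_sq.2 this
  linarith

/-! ### Closed form and gradient of the loss of one hidden unit. -/

section NeuronLoss

variable {E : Type*} [NormedAddCommGroup E] [InnerProductSpace ℝ E] [FiniteDimensional ℝ E]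
  [MeasurableSpace E] [BorelSpace E]

/-- The expected squared loss of one hidden unit with weights `w` and target weights `v` on a
standard Gaussian input. -/
def neuronLoss (v w : E) : ℝ :=
  ∫ z, 1 / 2 * (relu (inner ℝ w z) - relu (inner ℝ v z)) ^ 2 ∂(stdGaussian E)

lemma memLp_relu_inner (w : E) : MemLp (fun z => relu (inner ℝ w z)) 2 (stdGaussian E) :=
  (memLp_inner_stdGaussian w).pos_part.const_mul _

lemma integrable_neuronLoss (v w : E) :
    Integrable (fun z => 1 / 2 * (relu (inner ℝ w z) - relu (inner ℝ v z)) ^ 2)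
      (stdGaussian E) :=
  ((memLp_relu_inner w).sub (memLp_relu_inner v)).integrable_sq.const_mul _

lemma neuronLoss_le (v w : E) : neuronLoss v w ≤ ‖w - v‖ ^ 2 := by
  rw [← integral_sq_inner_stdGaussian]
  refine integral_mono (integrable_neuronLoss v w)
    (memLp_inner_stdGaussian (w - v)).integrable_sq fun z => ?_
  have := relu_sub_relu_sq_le (inner ℝ w z) (inner ℝ v z)
  simp only [inner_sub_left]
  linarith

/-- By the symmetry `z ↦ -z`, the integrals over the two half-spaces agree, and together they give
twice the second moment of `⟨w, z⟩`. -/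
lemma integral_relu_inner_sq (w : E) :
    ∫ z, relu (inner ℝ w z) ^ 2 ∂(stdGaussian E) = ‖w‖ ^ 2 := by
  have hneg : ∫ z, relu (inner ℝ w (-z)) ^ 2 ∂(stdGaussian E) =
      ∫ z, relu (inner ℝ w z) ^ 2 ∂(stdGaussian E) := by
    have h := stdGaussian_map (LinearIsometryEquiv.neg ℝ (E := E))
    conv_rhs => rw [← h]
    rw [integral_map (by fun_prop)]
    · rfl
    · have := continuous_relu
      fun_prop
  have hint := (memLp_relu_inner w).integrable_sq
  have hint' : Integrable (fun z => relu (inner ℝ w (-z)) ^ 2) (stdGaussian E) := by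
    have := (memLp_relu_inner (-w)).integrable_sq
    simpa only [inner_neg_left, inner_neg_right] using this
  have hsum : ∫ z, (relu (inner ℝ w z) ^ 2 + relu (inner ℝ w (-z)) ^ 2) ∂(stdGaussian E) =
      2 * ‖w‖ ^ 2 := by
    rw [← integral_sq_inner_stdGaussian, ← integral_const_mul]
    refine integral_congr_ae (Filter.Eventually.of_forall fun z => ?_)
    simp only [inner_neg_right, relu_sq]
    rcases le_total 0 (inner ℝ w z) with h | h
    · rw [max_eq_left h, max_eq_right (by linarith)]; ring
    · rw [max_eq_right h, max_eq_left (by linarith)]; ring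
  rw [integral_add hint hint', hneg] at hsum
  linarith

/-- Writing `w = x v + y e` with `e` a unit vector orthogonal to `v` turns this into the planar
integral. -/
lemma integral_relu_inner_mul {v w : E} (hv : ‖v‖ = 1) (hw : 0 < ‖w - inner ℝ v w • v‖) :
    ∫ z, relu (inner ℝ w z) * relu (inner ℝ v z) ∂(stdGaussian E) =
      (‖w - inner ℝ v w • v‖ + (Real.pi / 2 +
        Real.arctan (inner ℝ v w / ‖w - inner ℝ v w • v‖)) * inner ℝ v w) / Real.pi := by
  set x := inner ℝ v w with hx
  set y := ‖w - x • v‖ with hy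
  set e := y⁻¹ • (w - x • v) with he
  have hvv : inner ℝ v v = 1 := by rw [real_inner_self_eq_norm_sq, hv, one_pow]
  have he1 : ‖e‖ = 1 := by
    rw [he, norm_smul, norm_inv, Real.norm_of_nonneg hw.le, ← hy, inv_mul_cancel₀ hw.ne']
  have hve : inner ℝ v e = 0 := by
    rw [he, inner_smul_right, inner_sub_right, inner_smul_right, hvv, ← hx]
    ring
  have hwe : w = x • v + y • e := by
    rw [he, smul_smul, mul_inv_cancel₀ hw.ne', one_smul, add_sub_cancel]
  have hmap := map_inner_prod_stdGaussian hv he1 hve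
  have hG := integral_gaussian_max_mul_max x hw
  rw [← hmap, integral_map (by fun_prop) (by fun_prop)] at hG
  have hrew : ∀ z, relu (inner ℝ w z) * relu (inner ℝ v z) =
      2 * (max (inner ℝ v z) 0 * max (x * inner ℝ v z + y * inner ℝ e z) 0) := by
    intro z
    rw [relu_mul_relu]
    conv_lhs => rw [hwe, inner_add_left, real_inner_smul_left, real_inner_smul_left]
  simp_rw [hrew]
  rw [integral_const_mul, hG]
  field_simp

lemma neuronLoss_eq {v w : E} (hv : ‖v‖ = 1) (hw : 0 < ‖w - inner ℝ v w • v‖) :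
    neuronLoss v w = 1 / 2 * (‖w‖ ^ 2 + 1) - (‖w - inner ℝ v w • v‖ + (Real.pi / 2 +
        Real.arctan (inner ℝ v w / ‖w - inner ℝ v w • v‖)) * inner ℝ v w) / Real.pi := by
  have h1 := (memLp_relu_inner w).integrable_sq
  have h2 := (memLp_relu_inner v).integrable_sq
  have h3 : Integrable (fun z => relu (inner ℝ w z) * relu (inner ℝ v z)) (stdGaussian E) :=
    (memLp_relu_inner w).integrable_mul (memLp_relu_inner v)
  have h12 : Integrable (fun z => 1 / 2 * (relu (inner ℝ w z) ^ 2 + relu (inner ℝ v z) ^ 2))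
      (stdGaussian E) := (h1.add h2).const_mul _
  have hexp : ∀ z, 1 / 2 * (relu (inner ℝ w z) - relu (inner ℝ v z)) ^ 2 =
      1 / 2 * (relu (inner ℝ w z) ^ 2 + relu (inner ℝ v z) ^ 2) -
        relu (inner ℝ w z) * relu (inner ℝ v z) := fun z => by ring
  unfold neuronLoss
  simp_rw [hexp]
  rw [integral_sub h12 h3, integral_const_mul, integral_add h1 h2,
    integral_relu_inner_sq, integral_relu_inner_sq, integral_relu_inner_mul hv hw, hv, one_pow]

/-- The gradient of the loss of one hidden unit has the component `x - alignDrift (x / y)` along the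
target direction, where `x` and `y` are the coordinates of the weights along the target direction
and orthogonal to it. -/
def alignDrift (u : ℝ) : ℝ := (Real.pi / 2 + Real.arctan u + u / (1 + u ^ 2)) / Real.pi

lemma hasGradientAt_neuronLoss {v w : E} (hv : ‖v‖ = 1) (hw : 0 < ‖w - inner ℝ v w • v‖) :
    HasGradientAt (neuronLoss v)
      (w - alignDrift (inner ℝ v w / ‖w - inner ℝ v w • v‖) • v -
        (1 / (Real.pi * (1 + (inner ℝ v w / ‖w - inner ℝ v w • v‖) ^ 2)) *
          ‖w - inner ℝ v w • v‖⁻¹) • (w - inner ℝ v w • v)) w := by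
  -- Being off the line `ℝv` is an open condition, so the closed form can be differentiated in place
  -- of the integral.
  have hev : ∀ᶠ w' in nhds w, 0 < ‖w' - inner ℝ v w' • v‖ :=
    ContinuousAt.eventually_lt continuousAt_const (by fun_prop) hw
  have hcl : neuronLoss v =ᶠ[nhds w] fun w => 1 / 2 * (‖w‖ ^ 2 + 1) -
      (‖w - inner ℝ v w • v‖ + (Real.pi / 2 +
        Real.arctan (inner ℝ v w / ‖w - inner ℝ v w • v‖)) * inner ℝ v w) / Real.pi :=
    hev.mono fun w' hw' => neuronLoss_eq hv hw'
  rw [hasGradientAt_iff_hasFDerivAt]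
  refine HasFDerivAt.congr_of_eventuallyEq ?_ hcl
  have hvv : inner ℝ v v = 1 := by rw [real_inner_self_eq_norm_sq, hv, one_pow]
  have hx : HasFDerivAt (fun w : E => inner ℝ v w) (innerSL ℝ v) w :=
    (innerSL ℝ v).hasFDerivAt
  have hp : HasFDerivAt (fun w : E => w - inner ℝ v w • v)
      (ContinuousLinearMap.id ℝ E - (innerSL ℝ v).smulRight v) w :=
    (hasFDerivAt_id w).sub (hx.smul_const v)
  have hy : HasFDerivAt (fun w : E => ‖w - inner ℝ v w • v‖)
      (‖w - inner ℝ v w • v‖⁻¹ • innerSL ℝ (w - inner ℝ v w • v)) w := by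
    have h := (hp.norm_sq).sqrt (by positivity)
    simp only [Real.sqrt_sq (norm_nonneg _)] at h
    convert h using 1
    ext d
    simp only [smul_apply, ContinuousLinearMap.comp_apply,
      sub_apply, ContinuousLinearMap.id_apply,
      ContinuousLinearMap.smulRight_apply, innerSL_apply_apply, smul_eq_mul, nsmul_eq_mul,
      inner_sub_left, inner_sub_right, real_inner_smul_left, real_inner_smul_right, hvv,
      real_inner_comm w v]
    field_simp
    push_cast
    ring
  have hn : HasFDerivAt (fun w : E => ‖w‖ ^ 2) (2 • innerSL ℝ w) w :=
    (hasStrictFDerivAt_norm_sq w).hasFDerivAt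
  set x := inner ℝ v w with hxdef
  set y := ‖w - x • v‖ with hydef
  have hu : HasFDerivAt (fun w : E => inner ℝ v w / ‖w - inner ℝ v w • v‖) _ w :=
    hx.mul ((hasDerivAt_inv hw.ne').comp_hasFDerivAt w hy)
  have htot := ((hn.add_const 1).const_mul (1 / 2)).sub
    ((hy.add ((hu.arctan.const_add (Real.pi / 2)).mul hx)).mul_const Real.pi⁻¹)
  refine htot.congr_fderiv ?_
  ext d
  simp only [smul_apply, add_apply,
      sub_apply, innerSL_apply_apply, smul_eq_mul, nsmul_eq_mul,
      InnerProductSpace.toDual_apply_apply, inner_sub_left, real_inner_smul_left, alignDrift]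
  simp only [← hxdef, ← hydef]
  have hpi := Real.pi_pos
  have hq : 0 < y ^ 2 + x ^ 2 := by positivity
  field_simp
  ring

end NeuronLoss

/-! ### Factorization of the risk and bounds on its graph-dependent factor. -/

section ExpectedRisk

variable {n h r : ℕ}

/-- The mean squared norm of the rows of the normalized adjacency matrix. -/
def aggScale (S : Finset (Fin n)) (N : Fin n → Finset (Fin n)) : ℝ :=
  1 / (S.card : ℝ) * ∑ i ∈ S, ∑ j, normAdj S N i j ^ 2

/-- The aggregated feature is `‖a‖` times a standard Gaussian, and the squared loss is homogeneous
of degree two in it. -/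
lemma integral_nodeLoss (a : Fin n → ℝ) (Wstar W : Params h r) :
    ∫ X, nodeLoss a (Matrix.of X) Wstar W ∂featureLaw n r =
      (∑ i, a i ^ 2) * ∑ j, neuronLoss (Wstar j) (W j) := by
  set F : EuclideanSpace ℝ (Fin r) → ℝ := fun z =>
    ∑ j, 1 / 2 * (relu (inner ℝ (W j) z) - relu (inner ℝ (Wstar j) z)) ^ 2 with hF
  have hFc : Continuous F := by
    have := continuous_relu
    fun_prop
  have hmeas : Measurable (fun X : Fin n → Fin r → ℝ =>
      (WithLp.toLp 2 (a ᵥ* Matrix.of X) : EuclideanSpace ℝ (Fin r))) := by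
    refine (WithLp.measurable_toLp 2 _).comp (measurable_pi_lambda _ fun k => ?_)
    simp only [Matrix.vecMul, dotProduct, Matrix.of_apply]
    fun_prop
  have hnode : ∀ X : Fin n → Fin r → ℝ, nodeLoss a (Matrix.of X) Wstar W =
      F (WithLp.toLp 2 (a ᵥ* Matrix.of X)) := by
    intro X
    simp only [nodeLoss, gnnOutput, hF, Finset.mul_sum, dotProduct, PiLp.inner_apply,
      RCLike.inner_apply, conj_trivial]
  have hc : 0 ≤ ∑ i, a i ^ 2 := Finset.sum_nonneg fun i _ => sq_nonneg _
  have hscale : ∀ z, F (√(∑ i, a i ^ 2) • z) = (∑ i, a i ^ 2) * F z := by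
    intro z
    simp only [hF, Finset.mul_sum, real_inner_smul_right, relu_mul_of_nonneg (Real.sqrt_nonneg _)]
    refine Finset.sum_congr rfl fun j _ => ?_
    rw [← mul_sub, mul_pow, Real.sq_sqrt hc]
    ring
  simp_rw [hnode]
  rw [← integral_map (φ := fun X : Fin n → Fin r → ℝ =>
      (WithLp.toLp 2 (a ᵥ* Matrix.of X) : EuclideanSpace ℝ (Fin r))) (f := F)
      hmeas.aemeasurable hFc.aestronglyMeasurable, map_featureLaw_vecMul,
    integral_map (by fun_prop) hFc.aestronglyMeasurable]
  simp_rw [hscale]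
  rw [integral_const_mul, hF, integral_finsetSum]
  · rfl
  · exact fun j _ => integrable_neuronLoss _ _

lemma expectedRisk_eq (S : Finset (Fin n)) (N : Fin n → Finset (Fin n)) (Wstar W : Params h r) :
    expectedRisk S N Wstar W = aggScale S N * ∑ j, neuronLoss (Wstar j) (W j) := by
  simp only [expectedRisk, integral_nodeLoss, aggScale, ← Finset.sum_mul, mul_assoc]

lemma gradient_expectedRisk (S : Finset (Fin n)) (N : Fin n → Finset (Fin n))
    (Wstar W : Params h r) (g : Fin h → EuclideanSpace ℝ (Fin r))
    (hg : ∀ j, HasGradientAt (neuronLoss (Wstar j)) (g j) (W j)) :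
    ∇ (expectedRisk S N Wstar) W = WithLp.toLp 2 fun j => aggScale S N • g j := by
  refine HasGradientAt.gradient ?_
  rw [hasGradientAt_iff_hasFDerivAt]
  have h1 : ∀ j ∈ Finset.univ, HasFDerivAt (fun W : Params h r => neuronLoss (Wstar j) (W j))
      ((InnerProductSpace.toDual ℝ _ (g j)).comp
        (PiLp.proj 2 (fun _ : Fin h => EuclideanSpace ℝ (Fin r)) j)) W := fun j _ =>
    (hg j).hasFDerivAt.comp (f := fun W : Params h r => W j) W (PiLp.hasFDerivAt_apply 2 W j)
  have h2 := (HasFDerivAt.fun_sum h1).const_mul (aggScale S N)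
  have h3 : expectedRisk S N Wstar =
      fun W => aggScale S N * ∑ j, neuronLoss (Wstar j) (W j) :=
    funext (expectedRisk_eq S N Wstar)
  rw [h3]
  refine h2.congr_fderiv ?_
  ext d
  simp [PiLp.inner_apply, Finset.mul_sum, mul_left_comm]

/-- As `i ∉ N i`, the two indicators are never both 1, so the numerator is its own square. -/
lemma normAdj_sq (S : Finset (Fin n)) {N : Fin n → Finset (Fin n)} (hN : ∀ i, i ∉ N i)
    (i j : Fin n) :
    normAdj S N i j ^ 2 = ((if j ∈ N i then 1 else 0) + (if i = j then 1 else 0)) /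
      (((inDeg N i : ℝ) + 1) * ((outDeg S N j : ℝ) + 1)) := by
  rw [normAdj, div_pow, mul_pow, Real.sq_sqrt (by positivity), Real.sq_sqrt (by positivity)]
  congr 1
  by_cases h : i = j
  · subst h; simp [hN]
  · simp [h]

/-- Row `i` has `inDeg N i + 1` nonzero entries, each with square at most `1 / (inDeg N i + 1)`. -/
lemma aggScale_le_one (S : Finset (Fin n)) {N : Fin n → Finset (Fin n)} (hN : ∀ i, i ∉ N i) :
    aggScale S N ≤ 1 := by
  have hrow : ∀ i ∈ S, ∑ j, normAdj S N i j ^ 2 ≤ 1 := by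
    intro i _
    calc ∑ j, normAdj S N i j ^ 2
        ≤ ∑ j, ((if j ∈ N i then 1 else 0) + (if i = j then 1 else 0)) / ((inDeg N i : ℝ) + 1) := by
          refine Finset.sum_le_sum fun j _ => ?_
          rw [normAdj_sq S hN]
          refine div_le_div_of_nonneg_left (by positivity) (by positivity) ?_
          have : (0 : ℝ) ≤ outDeg S N j := by positivity
          nlinarith [show (0 : ℝ) ≤ inDeg N i by positivity]
      _ = 1 := by
          rw [← Finset.sum_div, Finset.sum_add_distrib]
          simp only [Finset.sum_ite_mem, Finset.univ_inter, Finset.sum_const, nsmul_eq_mul,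
            mul_one, Finset.sum_ite_eq, Finset.mem_univ, if_true, inDeg]
          exact div_self (by positivity)
  have := Finset.sum_le_sum hrow
  simp only [Finset.sum_const, nsmul_eq_mul, mul_one] at this
  rw [aggScale, one_div_mul_eq_div]
  exact div_le_one_of_le₀ this (by positivity)

lemma sum_outDeg_le (S : Finset (Fin n)) {N : Fin n → Finset (Fin n)} {β : ℕ}
    (hβ : ∀ i, (N i).card ≤ β) : ∑ j ∈ S, outDeg S N j ≤ S.card * β := by
  calc ∑ j ∈ S, outDeg S N j ≤ ∑ j, outDeg S N j :=
        Finset.sum_le_sum_of_subset (Finset.subset_univ S)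
    _ = ∑ i ∈ S, (N i).card := by
        simp only [outDeg, Finset.card_filter]
        rw [Finset.sum_comm]
        simp
    _ ≤ S.card * β := by
        simpa using Finset.sum_le_sum fun i (_ : i ∈ S) => hβ i

/-- The diagonal entries suffice. Edge counting bounds the total of `outDeg + 1` over `S` by `|S| (β
+ 1)`, and Cauchy–Schwarz then bounds the sum of the reciprocals from below. -/
lemma le_aggScale {S : Finset (Fin n)} (hS : S.Nonempty) {N : Fin n → Finset (Fin n)}
    (hN : ∀ i, i ∉ N i) {β : ℕ} (hβ : ∀ i, (N i).card ≤ β) :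
    1 / ((β : ℝ) + 1) ^ 2 ≤ aggScale S N := by
  have hb : (0 : ℝ) < S.card := by exact_mod_cast hS.card_pos
  have hdiag : ∀ i ∈ S, 1 / ((β : ℝ) + 1) * (1 ^ 2 / ((outDeg S N i : ℝ) + 1)) ≤
      ∑ j, normAdj S N i j ^ 2 := by
    intro i _
    refine le_trans ?_ (Finset.single_le_sum (f := fun j => normAdj S N i j ^ 2)
      (fun j _ => sq_nonneg _) (Finset.mem_univ i))
    simp only [normAdj_sq S hN, if_neg (hN i), if_true, zero_add]
    rw [one_pow, one_div_mul_one_div]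
    refine one_div_le_one_div_of_le (by positivity) ?_
    have : (inDeg N i : ℝ) ≤ β := by exact_mod_cast hβ i
    gcongr
  have hcs := Finset.sq_sum_div_le_sum_sq_div S (fun _ => (1 : ℝ))
    (g := fun i => (outDeg S N i : ℝ) + 1) fun i _ => by positivity
  have hsum : ∑ i ∈ S, ((outDeg S N i : ℝ) + 1) ≤ S.card * (β + 1) := by
    rw [Finset.sum_add_distrib, mul_add]
    have : (∑ i ∈ S, (outDeg S N i : ℝ)) ≤ S.card * β := by exact_mod_cast sum_outDeg_le S hβ
    simpa using this
  have hpos : 0 < ∑ i ∈ S, ((outDeg S N i : ℝ) + 1) :=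
    Finset.sum_pos (fun i _ => by positivity) hS
  have h1 : (S.card : ℝ) / (β + 1) ≤ ∑ i ∈ S, 1 ^ 2 / ((outDeg S N i : ℝ) + 1) := by
    refine le_trans ?_ hcs
    simp only [Finset.sum_const, nsmul_eq_mul, mul_one]
    rw [div_le_div_iff₀ (by positivity) hpos]
    nlinarith
  have h2 := Finset.sum_le_sum hdiag
  rw [← Finset.mul_sum] at h2
  rw [aggScale, one_div_mul_eq_div, le_div_iff₀ hb]
  refine le_trans ?_ h2
  calc 1 / ((β : ℝ) + 1) ^ 2 * S.card = 1 / ((β : ℝ) + 1) * (S.card / (β + 1)) := by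
        field_simp
    _ ≤ _ := by gcongr

end ExpectedRisk

/-! ### One SGD step in the coordinates along and orthogonal to the target. -/

section Dynamics

variable {n h r : ℕ}

/-- All units must be off their target lines, not only unit `j`, because the gradient is taken of
the joint risk. -/
lemma sgd_succ_apply {η : ℕ → ℝ} {s : ℕ → Sample n} {Wstar W₀ : Params h r} {t : ℕ}
    (hv : ∀ j, ‖Wstar j‖ = 1)
    (hy : ∀ j, 0 < ‖sgd η s Wstar W₀ t j - inner ℝ (Wstar j) (sgd η s Wstar W₀ t j) • Wstar j‖)
    {γ : ℝ} (hγ : γ = η t * aggScale (s t).batch (s t).nbrs) (j : Fin h)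
    {w v : EuclideanSpace ℝ (Fin r)} (hw : w = sgd η s Wstar W₀ t j) (hvj : v = Wstar j) :
    sgd η s Wstar W₀ (t + 1) j = w - γ •
      (w - alignDrift (inner ℝ v w / ‖w - inner ℝ v w • v‖) • v -
        (1 / (Real.pi * (1 + (inner ℝ v w / ‖w - inner ℝ v w • v‖) ^ 2)) *
          ‖w - inner ℝ v w • v‖⁻¹) • (w - inner ℝ v w • v)) := by
  have hgrad := gradient_expectedRisk (s t).batch (s t).nbrs Wstar (sgd η s Wstar W₀ t) _
    fun j => hasGradientAt_neuronLoss (hv j) (hy j)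
  rw [sgd, hgrad, hγ, hw, hvj, mul_smul]
  rfl

/-- The component along `v` after one step with effective step size `γ`. -/
lemma inner_step {E : Type*} [NormedAddCommGroup E] [InnerProductSpace ℝ E] {v w : E}
    (hv : ‖v‖ = 1) (γ a d : ℝ) :
    inner ℝ v (w - γ • (w - a • v - d • (w - inner ℝ v w • v))) =
      (1 - γ) * inner ℝ v w + γ * a := by
  have hvv : inner ℝ v v = 1 := by rw [real_inner_self_eq_norm_sq, hv, one_pow]
  simp only [inner_sub_right, inner_smul_right, hvv]
  ring

/-- The distance from the line through `v` after one step with effective step size `γ`. -/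
lemma norm_step {E : Type*} [NormedAddCommGroup E] [InnerProductSpace ℝ E] {v w : E}
    (hv : ‖v‖ = 1) {γ a d : ℝ} (hγ : 0 ≤ γ) (hγ1 : γ ≤ 1) (hd : 0 ≤ d) :
    ‖(w - γ • (w - a • v - d • (w - inner ℝ v w • v))) -
        inner ℝ v (w - γ • (w - a • v - d • (w - inner ℝ v w • v))) • v‖ =
      ((1 - γ) + γ * d) * ‖w - inner ℝ v w • v‖ := by
  have : (w - γ • (w - a • v - d • (w - inner ℝ v w • v))) -
        inner ℝ v (w - γ • (w - a • v - d • (w - inner ℝ v w • v))) • v =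
      ((1 - γ) + γ * d) • (w - inner ℝ v w • v) := by
    rw [inner_step hv]
    module
  rw [this, norm_smul, Real.norm_of_nonneg]
  nlinarith [mul_nonneg hγ hd]

end Dynamics

/-! ### Monotonicity and quantitative bounds for the drift function. -/

section AlignDrift

lemma hasDerivAt_alignDrift (u : ℝ) :
    HasDerivAt alignDrift (2 / (1 + u ^ 2) ^ 2 / Real.pi) u := by
  have hq : (1 : ℝ) + u ^ 2 ≠ 0 := by positivity
  have h := ((((Real.hasDerivAt_arctan u).const_add (Real.pi / 2)).add
    ((hasDerivAt_id u).div (((hasDerivAt_id u).pow 2).const_add 1) hq)).div_const Real.pi)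
  refine h.congr_deriv ?_
  simp only [id, Pi.pow_apply, Nat.cast_ofNat]
  field_simp
  ring

lemma monotone_alignDrift : Monotone alignDrift :=
  monotone_of_hasDerivAt_nonneg hasDerivAt_alignDrift fun u => by
    have := Real.pi_pos
    simp only [Pi.zero_apply]
    positivity

/-- This reflection turns lower bounds into upper bounds and fixes the value `1/2` at zero. -/
lemma alignDrift_neg (u : ℝ) : alignDrift (-u) = 1 - alignDrift u := by
  have := Real.pi_pos
  rw [alignDrift, alignDrift, Real.arctan_neg, neg_sq]
  field_simp
  ring

lemma half_le_alignDrift {u : ℝ} (hu : 0 ≤ u) : 1 / 2 ≤ alignDrift u := by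
  have h := monotone_alignDrift hu
  have h0 : alignDrift 0 = 1 / 2 := by
    have := alignDrift_neg 0
    rw [neg_zero] at this
    linarith
  rwa [h0] at h

/-- The drift is positive even for weights pointing away from the target, and decays only
polynomially there. A start at distance `ρ` from the line thus costs only logarithmic time in `1/ρ`.
-/
lemma le_alignDrift (u : ℝ) : 1 / (2 * Real.pi * √(1 + u ^ 2) ^ 3) ≤ alignDrift u := by
  have hpi := Real.pi_gt_three
  have hq : (1 : ℝ) ≤ √(1 + u ^ 2) := Real.one_le_sqrt.2 (by nlinarith [sq_nonneg u])
  rcases le_or_gt 0 u with hu | hu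
  · refine le_trans ?_ (half_le_alignDrift hu)
    refine one_div_le_one_div_of_le (by norm_num) ?_
    have : 1 ≤ √(1 + u ^ 2) ^ 3 := one_le_pow₀ hq
    nlinarith
  · set s := √(1 + u ^ 2) with hs
    have hs2 : s ^ 2 = 1 + u ^ 2 := Real.sq_sqrt (by positivity)
    have hsu : -u ≤ s := Real.le_sqrt_of_sq_le (by nlinarith)
    have hφ : 1 / s ≤ Real.pi / 2 + Real.arctan u := by
      have h1 := Real.cos_arctan u
      have h2 : Real.sin (Real.pi / 2 + Real.arctan u) = 1 / s := by
        rw [add_comm, Real.sin_add_pi_div_two, h1]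
      rw [← h2]
      exact Real.sin_le (by linarith [Real.neg_pi_div_two_lt_arctan u])
    have hspos : 0 < s := by linarith
    rw [alignDrift, ← hs2, le_div_iff₀ (by positivity)]
    -- Uses `(s - u)(s + u) = 1` to rewrite `1/s + u/s²`, where the two terms nearly cancel.
    calc 1 / (2 * Real.pi * s ^ 3) * Real.pi = 1 / (s ^ 2 * (2 * s)) := by field_simp
      _ ≤ 1 / (s ^ 2 * (s - u)) := by
          refine one_div_le_one_div_of_le (by nlinarith [sq_pos_of_pos hspos]) ?_
          gcongr
          linarith
      _ = 1 / s + u / s ^ 2 := by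
          have : s - u ≠ 0 := by linarith
          field_simp
          nlinarith
      _ ≤ _ := by linarith

lemma alignDrift_nonneg (u : ℝ) : 0 ≤ alignDrift u :=
  le_trans (by have := Real.pi_pos; positivity) (le_alignDrift u)

lemma alignDrift_le_one (u : ℝ) : alignDrift u ≤ 1 := by
  have h := alignDrift_nonneg (-u)
  rw [alignDrift_neg] at h
  linarith

/-- Here `π/2 - arctan u = arctan (1/u) ≤ 1/u`, and the remaining term has a favourable sign. -/
lemma one_sub_alignDrift_le {u : ℝ} (hu : 0 < u) : 1 - alignDrift u ≤ 1 / (Real.pi * u) := by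
  have hpi := Real.pi_pos
  have h1 : Real.arctan u⁻¹ ≤ u⁻¹ := by
    have h := Real.le_tan (x := Real.arctan u⁻¹) (Real.arctan_nonneg.2 (by positivity))
      (Real.arctan_lt_pi_div_two _)
    rwa [Real.tan_arctan] at h
  rw [Real.arctan_inv_of_pos hu] at h1
  rw [alignDrift, one_sub_div hpi.ne', ← div_div, div_right_comm]
  gcongr
  have : 0 ≤ u / (1 + u ^ 2) := by positivity
  rw [one_div]
  linarith

end AlignDrift

/-! ### Convergence of the planar recursion. -/

section ScalarDynamics

/-- The sign of `d` is left free, so that the bound also applies to one-sided gaps such as `1/2 -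
x`. -/
lemma le_mul_exp_of_contraction {d γ : ℕ → ℝ} {g D : ℝ} (hD : 0 ≤ D) (h0 : d 0 ≤ D)
    (hγ : ∀ t, g ≤ γ t ∧ γ t ≤ 1) (hd : ∀ t, d (t + 1) ≤ (1 - γ t) * d t) (t : ℕ) :
    d t ≤ D * Real.exp (-(g * t)) := by
  induction t with
  | zero => simpa using h0
  | succ t ih =>
    have hE := Real.exp_pos (-(g * t))
    calc d (t + 1) ≤ (1 - γ t) * d t := hd t
      _ ≤ (1 - γ t) * (D * Real.exp (-(g * t))) :=
          mul_le_mul_of_nonneg_left ih (by linarith [(hγ t).2])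
      _ ≤ Real.exp (-g) * (D * Real.exp (-(g * t))) := by
          refine mul_le_mul_of_nonneg_right ?_ (by positivity)
          linarith [(hγ t).1, Real.add_one_le_exp (-g)]
      _ = D * Real.exp (-(g * (t + 1 : ℕ))) := by
          rw [mul_left_comm, ← Real.exp_add]
          congr 2
          push_cast
          ring

/-- Evolution of the coordinates `x` along the target direction and `y` orthogonal to it of the
weights of one hidden unit under gradient descent with step sizes `γ`. -/
structure IsNeuronPath (γ x y : ℕ → ℝ) : Prop where
  pos : ∀ t, 0 < y t
  align : ∀ t, x (t + 1) = (1 - γ t) * x t + γ t * alignDrift (x t / y t)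
  orth : ∀ t, y (t + 1) =
    ((1 - γ t) + γ t * (1 / (Real.pi * (1 + (x t / y t) ^ 2)) * (y t)⁻¹)) * y t

variable {γ x y : ℕ → ℝ} {g : ℝ}

namespace IsNeuronPath

lemma orth' (hp : IsNeuronPath γ x y) (t : ℕ) :
    y (t + 1) = (1 - γ t) * y t + γ t * (1 / (Real.pi * (1 + (x t / y t) ^ 2))) := by
  have := (hp.pos t).ne'
  rw [hp.orth, add_mul, mul_assoc (γ t), mul_assoc (1 / _), inv_mul_cancel₀ this, mul_one]

/-- The weights only turn towards the target: with `u = x t / y t`, the cross difference `x (t+1) y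
t - x t y (t+1)` equals `γ t · y t · (π/2 + arctan u)/π`. -/
lemma monotone_ratio (hp : IsNeuronPath γ x y) (hγ : ∀ t, 0 ≤ γ t) :
    Monotone fun t => x t / y t := by
  refine monotone_nat_of_le_succ fun t => ?_
  have hy := hp.pos t
  have hpi := Real.pi_pos
  rw [div_le_div_iff₀ hy (hp.pos (t + 1)), hp.align, hp.orth']
  set u := x t / y t with hu
  have hx : x t = u * y t := by rw [hu, div_mul_cancel₀ _ hy.ne']
  have key : 0 ≤ alignDrift u - u * (1 / (Real.pi * (1 + u ^ 2))) := by
    have h : alignDrift u - u * (1 / (Real.pi * (1 + u ^ 2))) =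
        (Real.pi / 2 + Real.arctan u) / Real.pi := by
      rw [alignDrift]
      field_simp
      ring
    rw [h]
    have := Real.neg_pi_div_two_lt_arctan u
    exact div_nonneg (by linarith) hpi.le
  rw [hx]
  nlinarith [mul_nonneg (mul_nonneg (hγ t) hy.le) key]

/-- Each step averages `x` with a number in `[0, 1]`, so a bound `R ≥ 1` persists; `orth_le` is the
same for `y`. -/
lemma abs_align_le (hp : IsNeuronPath γ x y) (hγ : ∀ t, 0 ≤ γ t ∧ γ t ≤ 1) {R : ℝ} (hR : 1 ≤ R)
    (h0 : |x 0| ≤ R) (t : ℕ) : |x t| ≤ R := by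
  induction t with
  | zero => exact h0
  | succ t ih =>
    have h1 := alignDrift_nonneg (x t / y t)
    have h2 := alignDrift_le_one (x t / y t)
    rw [abs_le] at ih ⊢
    rw [hp.align]
    constructor <;> nlinarith [(hγ t).1, (hγ t).2]

lemma orth_le (hp : IsNeuronPath γ x y) (hγ : ∀ t, 0 ≤ γ t ∧ γ t ≤ 1) {R : ℝ} (hR : 1 ≤ R)
    (h0 : y 0 ≤ R) (t : ℕ) : y t ≤ R := by
  induction t with
  | zero => exact h0
  | succ t ih =>
    have hpi := Real.pi_gt_three
    have h1 : 1 / (Real.pi * (1 + (x t / y t) ^ 2)) ≤ 1 := by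
      refine div_le_one_of_le₀ ?_ (by positivity)
      nlinarith [sq_nonneg (x t / y t)]
    rw [hp.orth']
    nlinarith [(hγ t).1, (hγ t).2]

/-- Once `x ≥ 1/4`, the iterates contract towards the target `(1, 0)`. -/
lemma contraction (hp : IsNeuronPath γ x y) (hγ : ∀ t, 0 ≤ γ t ∧ γ t ≤ 1) {t : ℕ}
    (hx : 1 / 4 ≤ x t) :
    |x (t + 1) - 1| + 8 * y (t + 1) ≤ (1 - γ t / 10) * (|x t - 1| + 8 * y t) := by
  have hy := hp.pos t
  have hpi := Real.pi_gt_three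
  have hx0 : 0 < x t := by linarith
  have h1 : 1 - alignDrift (x t / y t) ≤ 4 / 3 * y t := by
    refine (one_sub_alignDrift_le (div_pos hx0 hy)).trans ?_
    rw [mul_div_assoc', one_div_div, div_le_iff₀ (by positivity)]
    nlinarith [mul_le_mul hpi.le hx (by norm_num) (by positivity)]
  -- From `x² + y² ≥ 2xy ≥ y/2` and `π > 3`.
  have h2 : 1 / (Real.pi * (1 + (x t / y t) ^ 2)) ≤ 2 / 3 * y t := by
    have : Real.pi * (1 + (x t / y t) ^ 2) = Real.pi * (y t ^ 2 + x t ^ 2) / y t ^ 2 := by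
      field_simp
    rw [this, one_div_div, div_le_iff₀ (by positivity)]
    have hsq : y t / 2 ≤ y t ^ 2 + x t ^ 2 := by nlinarith [sq_nonneg (y t - x t)]
    have := mul_le_mul hpi.le hsq (by positivity) (by positivity)
    nlinarith
  have h3 := alignDrift_le_one (x t / y t)
  have h4 : |x (t + 1) - 1| ≤ (1 - γ t) * |x t - 1| + γ t * (1 - alignDrift (x t / y t)) := by
    have : x (t + 1) - 1 = (1 - γ t) * (x t - 1) + γ t * (alignDrift (x t / y t) - 1) := by
      rw [hp.align]; ring
    rw [this]
    refine (abs_add_le _ _).trans ?_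
    rw [abs_mul, abs_mul, abs_of_nonneg (hγ t).1, abs_of_nonneg (sub_nonneg.2 (hγ t).2),
      abs_of_nonpos (sub_nonpos.2 h3), neg_sub]
  -- The weight 8 absorbs the coupling: the new terms total `(4/3 + 8 · 2/3) γ y = (20/3) γ y`,
  -- which is below `8 · (9/10) γ y`.
  have h5 := hp.orth' t
  have h6 := mul_le_mul_of_nonneg_left h1 (hγ t).1
  have h7 := mul_le_mul_of_nonneg_left h2 (hγ t).1
  have h8 := mul_nonneg (hγ t).1 hy.le
  have h9 := mul_nonneg (hγ t).1 (abs_nonneg (x t - 1))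
  nlinarith

/-- Convergence from every initial value off the line through the target: after `N` steps `x ≥ 0`,
after `2 N` steps `x ≥ 1/4`, and then the iterates contract. -/
theorem dist_sq_le (hp : IsNeuronPath γ x y) (hg : 0 < g) (hγ : ∀ t, g ≤ γ t ∧ γ t ≤ 1)
    {R ρ e : ℝ} (hR : 1 ≤ R) (hρ : 0 < ρ) (h0 : x 0 ^ 2 + y 0 ^ 2 ≤ R ^ 2) (hρy : ρ ≤ y 0)
    {N : ℕ} (hN1 : (1 + R) * Real.exp (-(g * N)) ≤ ρ ^ 3 / (2 * Real.pi * R ^ 3))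
    (hN2 : Real.exp (-(g * N)) ≤ 1 / 2)
    (hN3 : 10 * R * Real.exp (-(g / 10 * N)) ≤ e) {T : ℕ} (hT : 3 * N ≤ T) :
    (x T - 1) ^ 2 + y T ^ 2 ≤ e ^ 2 := by
  have hγ0 : ∀ t, 0 ≤ γ t ∧ γ t ≤ 1 := fun t => ⟨hg.le.trans (hγ t).1, (hγ t).2⟩
  have hpi := Real.pi_pos
  have hy0 := hp.pos 0
  have hx0R : |x 0| ≤ R := abs_le_of_sq_le_sq (by nlinarith) (by linarith)
  have hy0R : y 0 ≤ R := le_of_sq_le_sq (by nlinarith) (by linarith)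
  have hexp : ∀ {c : ℝ}, 0 ≤ c → ∀ {t : ℕ}, N ≤ t →
      Real.exp (-(c * t)) ≤ Real.exp (-(c * N)) := by
    intro c hc t ht
    have : (N : ℝ) ≤ t := by exact_mod_cast ht
    exact Real.exp_le_exp.2 (neg_le_neg (mul_le_mul_of_nonneg_left this hc))
  -- `√(1 + (x/y)²)` is the length of the weights over their distance from the line, hence initially
  -- at most `R / ρ`.
  have hA0 : ρ ^ 3 / (2 * Real.pi * R ^ 3) ≤ alignDrift (x 0 / y 0) := by
    refine le_trans ?_ (le_alignDrift _)
    have hs : √(1 + (x 0 / y 0) ^ 2) ≤ R / ρ := by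
      refine Real.sqrt_le_iff.2 ⟨by positivity, ?_⟩
      have : 1 + (x 0 / y 0) ^ 2 = (x 0 ^ 2 + y 0 ^ 2) / y 0 ^ 2 := by field_simp; ring
      rw [this, div_pow]
      gcongr
    have hs0 : 0 < √(1 + (x 0 / y 0) ^ 2) := Real.sqrt_pos.2 (by positivity)
    calc ρ ^ 3 / (2 * Real.pi * R ^ 3) = 1 / (2 * Real.pi * (R / ρ) ^ 3) := by field_simp
      _ ≤ _ := by gcongr
  -- The drift never falls below its initial value `a`, so `a - x` contracts; `hN1` brings it below
  -- `a`.
  have hx1 : ∀ t, N ≤ t → 0 ≤ x t := by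
    intro t ht
    have h := le_mul_exp_of_contraction (d := fun t => alignDrift (x 0 / y 0) - x t)
      (D := 1 + R) (by linarith)
      (by linarith [alignDrift_le_one (x 0 / y 0), neg_le_of_abs_le hx0R]) hγ
      (fun t => by
        have := monotone_alignDrift (hp.monotone_ratio (fun t => (hγ0 t).1) (Nat.zero_le t))
        simp only at this ⊢
        rw [hp.align]
        nlinarith [(hγ0 t).1]) t
    have := mul_le_mul_of_nonneg_left (hexp hg.le ht) (by linarith : 0 ≤ 1 + R)
    linarith
  -- With `x ≥ 0` the drift is at least `1/2`, so `1/2 - x` contracts from at most `1/2` to at most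
  -- `1/4`.
  have hx2 : ∀ t, 2 * N ≤ t → 1 / 4 ≤ x t := by
    intro t ht
    obtain ⟨k, rfl⟩ := Nat.exists_eq_add_of_le (show N ≤ t by omega)
    have h := le_mul_exp_of_contraction (d := fun t => 1 / 2 - x (N + t))
      (D := 1 / 2) (by norm_num) (by linarith [hx1 (N + 0) (by omega)])
      (fun t => hγ (N + t))
      (fun t => by
        have := half_le_alignDrift (div_nonneg (hx1 (N + t) (by omega)) (hp.pos (N + t)).le)
        rw [← add_assoc, hp.align]
        nlinarith [(hγ0 (N + t)).1]) k
    have := hexp hg.le (show N ≤ k by omega)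
    linarith
  obtain ⟨k, rfl⟩ := Nat.exists_eq_add_of_le (show 2 * N ≤ T by omega)
  -- The initial value `10 R` covers `|x - 1| + 8y ≤ (R + 1) + 8R`.
  have h := le_mul_exp_of_contraction (γ := fun t => γ (2 * N + t) / 10) (g := g / 10)
    (d := fun t => |x (2 * N + t) - 1| + 8 * y (2 * N + t))
    (D := 10 * R) (by linarith)
    (by
      have h1 := hp.abs_align_le hγ0 hR hx0R (2 * N)
      have h2 := hp.orth_le hγ0 hR hy0R (2 * N)
      have h3 := abs_sub (x (2 * N)) 1
      simp only [abs_one, add_zero] at h3 ⊢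
      linarith)
    (fun t => ⟨by linarith [(hγ (2 * N + t)).1], by linarith [(hγ (2 * N + t)).2]⟩)
    (fun t => hp.contraction hγ0 (hx2 _ (Nat.le_add_right _ _))) k
  have h1 := mul_le_mul_of_nonneg_left (hexp (by positivity : 0 ≤ g / 10) (show N ≤ k by omega))
    (by linarith : 0 ≤ 10 * R)
  have hE : |x (2 * N + k) - 1| + 8 * y (2 * N + k) ≤ e := by linarith
  have hyT := hp.pos (2 * N + k)
  have ha := abs_nonneg (x (2 * N + k) - 1)
  rw [← sq_abs (x _ - 1)]
  nlinarith

end IsNeuronPath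

end ScalarDynamics

/-! ### Gaussian initialization avoids long rows and rows near the target lines. -/

section Initialization

variable {h r : ℕ}

lemma pi_gaussianReal_sq_map_toLp (κ : ℝ≥0) :
    (Measure.pi fun _ : Fin r => gaussianReal 0 (κ ^ 2)).map (WithLp.toLp 2) =
      (stdGaussian (EuclideanSpace ℝ (Fin r))).map (fun z => (κ : ℝ) • z) := by
  have h1 : gaussianReal 0 (κ ^ 2) = (gaussianReal 0 1).map ((κ : ℝ) * ·) := by
    rw [gaussianReal_map_const_mul, mul_zero]
    congr 1
    ext
    simp
  rw [← map_pi_eq_stdGaussian, Measure.map_map (by fun_prop) (by fun_prop), h1,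
    ← Measure.pi_map_pi (fun _ => by fun_prop), Measure.map_map (by fun_prop) (by fun_prop)]
  rfl

lemma measurable_toLp_toLp : Measurable (fun M : Fin h → Fin r → ℝ =>
    (WithLp.toLp 2 fun j => WithLp.toLp 2 (M j) : Params h r)) :=
  (WithLp.measurable_toLp 2 _).comp (measurable_pi_lambda _ fun j =>
    (WithLp.measurable_toLp 2 _).comp (measurable_pi_apply j))

lemma map_eval_initLaw (κ : ℝ≥0) (j : Fin h) :
    (initLaw h r κ).map (fun W => W j) =
      (stdGaussian (EuclideanSpace ℝ (Fin r))).map (fun z => (κ : ℝ) • z) := by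
  have he := (measurePreserving_eval (fun _ : Fin h => Measure.pi fun _ : Fin r =>
    gaussianReal 0 (κ ^ 2)) j).map_eq
  rw [← pi_gaussianReal_sq_map_toLp, initLaw, Measure.map_map (by fun_prop) measurable_toLp_toLp]
  conv_rhs => rw [← he]
  rw [Measure.map_map (by fun_prop) (by fun_prop)]
  rfl

instance (κ : ℝ≥0) : IsProbabilityMeasure (initLaw h r κ) :=
  Measure.isProbabilityMeasure_map measurable_toLp_toLp.aemeasurable

/-- Markov's inequality for `‖z‖²`, whose mean is `r`. -/
lemma stdGaussian_norm_gt_le {R : ℝ} (hR : 0 < R) :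
    stdGaussian (EuclideanSpace ℝ (Fin r)) {z | R < ‖z‖} ≤ ENNReal.ofReal (r / R ^ 2) := by
  have hint : Integrable (fun z : EuclideanSpace ℝ (Fin r) => ‖z‖ ^ 2) (stdGaussian _) :=
    (IsGaussian.memLp_two_id (μ := stdGaussian (EuclideanSpace ℝ (Fin r)))).norm.integrable_sq
  have hval : ∫ z : EuclideanSpace ℝ (Fin r), ‖z‖ ^ 2 ∂(stdGaussian _) = r := by
    have : ∀ z : EuclideanSpace ℝ (Fin r), ‖z‖ ^ 2 =
        ∑ k, (inner ℝ (EuclideanSpace.single k (1 : ℝ)) z) ^ 2 := by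
      intro z
      simp [EuclideanSpace.real_norm_sq_eq, EuclideanSpace.inner_single_left]
    simp_rw [this]
    rw [integral_finsetSum]
    · simp_rw [integral_sq_inner_stdGaussian]
      simp
    · exact fun k _ => (memLp_inner_stdGaussian _).integrable_sq
  have hm := mul_meas_ge_le_integral_of_nonneg
    (Filter.Eventually.of_forall fun z : EuclideanSpace ℝ (Fin r) => sq_nonneg ‖z‖) hint (R ^ 2)
  rw [hval, mul_comm, ← le_div_iff₀ (by positivity)] at hm
  refine (measure_mono fun z hz => ?_).trans
    ((ENNReal.le_ofReal_iff_toReal_le (measure_ne_top _ _) (by positivity)).2 hm)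
  have hz' : R < ‖z‖ := hz
  simp only [Set.mem_ofPred_eq]
  gcongr

lemma gaussianReal_Ioo_le (a : ℝ) :
    gaussianReal 0 1 (Set.Ioo (-a) a) ≤ ENNReal.ofReal (2 * a) := by
  rw [gaussianReal_apply 0 one_ne_zero]
  calc ∫⁻ x in Set.Ioo (-a) a, gaussianPDF 0 1 x ≤ ∫⁻ _ in Set.Ioo (-a) a, 1 := by
        refine lintegral_mono fun x => ?_
        rw [gaussianPDF, gaussianPDFReal, ENNReal.ofReal_le_one]
        refine mul_le_one₀ (inv_le_one_of_one_le₀ (Real.one_le_sqrt.2 ?_)) (Real.exp_pos _).le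
          (Real.exp_le_one_iff.2 ?_)
        · have := Real.pi_gt_three
          simp only [NNReal.coe_one]
          linarith
        · rw [neg_div]
          simp only [NNReal.coe_one]
          exact neg_nonpos.2 (by positivity)
    _ = ENNReal.ofReal (2 * a) := by
        rw [setLIntegral_one, Real.volume_Ioo]
        congr 1
        ring

lemma exists_unit_orthogonal {E : Type*} [NormedAddCommGroup E] [InnerProductSpace ℝ E]
    [FiniteDimensional ℝ E] (hE : 2 ≤ Module.finrank ℝ E) (v : E) :
    ∃ e : E, ‖e‖ = 1 ∧ inner ℝ v e = 0 := by
  have h1 := (ℝ ∙ v).finrank_add_finrank_orthogonal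
  have h2 := finrank_span_le_card (R := ℝ) ({v} : Set E)
  simp only [Set.toFinset_singleton, Finset.card_singleton] at h2
  have h3 : 0 < Module.finrank ℝ (ℝ ∙ v)ᗮ := by omega
  have := Module.finrank_pos_iff.1 h3
  obtain ⟨e, he⟩ := exists_norm_eq (ℝ ∙ v)ᗮ (zero_le_one (α := ℝ))
  exact ⟨e, he, Submodule.mem_orthogonal_singleton_iff_inner_right.1 e.2⟩

/-- For a unit vector `e ⟂ v`, which exists as `r ≥ 2`, the norm on the left dominates `|⟨e, z⟩|`, a
standard normal with density at most 1. -/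
lemma stdGaussian_orth_lt_le (hr : 2 ≤ r) (v : EuclideanSpace ℝ (Fin r)) (ρ : ℝ) :
    stdGaussian (EuclideanSpace ℝ (Fin r)) {z | ‖z - inner ℝ v z • v‖ < ρ} ≤
      ENNReal.ofReal (2 * ρ) := by
  obtain ⟨e, he, hve⟩ := exists_unit_orthogonal (by simpa using hr) v
  refine le_trans ?_ (gaussianReal_Ioo_le ρ)
  have hmap := map_inner_stdGaussian e
  have h1 : ‖e‖₊ = 1 := by ext; simpa using he
  rw [h1, one_pow] at hmap
  rw [← hmap, Measure.map_apply (by fun_prop) measurableSet_Ioo]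
  refine measure_mono fun z hz => abs_lt.1 (lt_of_le_of_lt ?_ hz)
  have h2 : inner ℝ e z = inner ℝ e (z - inner ℝ v z • v) := by
    rw [inner_sub_right, inner_smul_right, real_inner_comm v e, hve, mul_zero, sub_zero]
  simp only [h2]
  simpa [he] using abs_real_inner_le_norm e (z - inner ℝ v z • v)

lemma measurableSet_generic (v : Params h r) (R ρ : ℝ) :
    MeasurableSet
      {W : Params h r | ∀ j, ‖W j‖ ≤ R ∧ ρ ≤ ‖W j - inner ℝ (v j) (W j) • v j‖} := by
  refine IsClosed.measurableSet ?_
  simp only [Set.ofPred_forall, Set.ofPred_and]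
  exact isClosed_iInter fun j => (isClosed_le (by fun_prop) (by fun_prop)).inter
    (isClosed_le (by fun_prop) (by fun_prop))

/-- With high probability no row of the Gaussian initialization is long or close to the line
through the corresponding row of the ground truth. -/
lemma le_initLaw_generic (hr : 2 ≤ r) {κ : ℝ≥0} (hκ : 0 < κ) (v : Params h r) {R ρ : ℝ}
    (hR : 0 < R) (hρ : 0 < ρ) :
    ENNReal.ofReal (1 - h * (r * κ ^ 2 / R ^ 2 + 2 * ρ / κ)) ≤
      initLaw h r κ {W | ∀ j, ‖W j‖ ≤ R ∧ ρ ≤ ‖W j - inner ℝ (v j) (W j) • v j‖} := by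
  have hκ' : (0 : ℝ) < κ := hκ
  set G := {W : Params h r | ∀ j, ‖W j‖ ≤ R ∧ ρ ≤ ‖W j - inner ℝ (v j) (W j) • v j‖} with hG
  have hGm : MeasurableSet G := measurableSet_generic v R ρ
  have hrow : ∀ j, initLaw h r κ
      {W | ¬ (‖W j‖ ≤ R ∧ ρ ≤ ‖W j - inner ℝ (v j) (W j) • v j‖)} ≤
      ENNReal.ofReal (r * κ ^ 2 / R ^ 2 + 2 * ρ / κ) := by
    intro j
    have hB : MeasurableSet {w : EuclideanSpace ℝ (Fin r) |
        ¬ (‖w‖ ≤ R ∧ ρ ≤ ‖w - inner ℝ (v j) w • v j‖)} := by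
      have h1 : IsClosed {w : EuclideanSpace ℝ (Fin r) | ‖w‖ ≤ R} :=
        isClosed_le (by fun_prop) (by fun_prop)
      have h2 : IsClosed {w : EuclideanSpace ℝ (Fin r) | ρ ≤ ‖w - inner ℝ (v j) w • v j‖} :=
        isClosed_le (by fun_prop) (by fun_prop)
      exact (h1.inter h2).measurableSet.compl
    have h1 := map_eval_initLaw (r := r) κ j
    have h2 := congrArg (fun μ => μ {w : EuclideanSpace ℝ (Fin r) |
        ¬ (‖w‖ ≤ R ∧ ρ ≤ ‖w - inner ℝ (v j) w • v j‖)}) h1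
    simp only at h2
    rw [Measure.map_apply (by fun_prop) hB, Measure.map_apply (by fun_prop) hB] at h2
    refine h2.le.trans ?_
    have hsub : (fun z : EuclideanSpace ℝ (Fin r) => (κ : ℝ) • z) ⁻¹'
        {w | ¬ (‖w‖ ≤ R ∧ ρ ≤ ‖w - inner ℝ (v j) w • v j‖)} ⊆
        {z | R / κ < ‖z‖} ∪ {z | ‖z - inner ℝ (v j) z • v j‖ < ρ / κ} := by
      intro z hz
      have hz' : ¬ (‖(κ : ℝ) • z‖ ≤ R ∧ ρ ≤ ‖(κ : ℝ) • z - inner ℝ (v j) ((κ : ℝ) • z) • v j‖) :=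
        hz
      rw [inner_smul_right, mul_smul, ← smul_sub, norm_smul, norm_smul,
        Real.norm_of_nonneg hκ'.le, not_and_or, not_le, not_le] at hz'
      refine hz'.imp (fun h => ?_) fun h => ?_
      · simp only [Set.mem_ofPred_eq]
        rwa [div_lt_iff₀' hκ']
      · simp only [Set.mem_ofPred_eq]
        rwa [lt_div_iff₀' hκ']
    refine (measure_mono hsub).trans ((measure_union_le _ _).trans ?_)
    rw [ENNReal.ofReal_add (by positivity) (by positivity)]
    refine add_le_add ((stdGaussian_norm_gt_le (by positivity)).trans_eq ?_)
      ((stdGaussian_orth_lt_le hr _ _).trans_eq ?_)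
    · congr 1
      field_simp
    · congr 1
      ring
  have hc : initLaw h r κ Gᶜ ≤ ENNReal.ofReal (h * (r * κ ^ 2 / R ^ 2 + 2 * ρ / κ)) := by
    have hU : Gᶜ ⊆ ⋃ j, {W : Params h r |
        ¬ (‖W j‖ ≤ R ∧ ρ ≤ ‖W j - inner ℝ (v j) (W j) • v j‖)} := by
      intro W hW
      simpa [hG, not_and_or] using hW
    refine (measure_mono hU).trans ((measure_iUnion_fintype_le _ _).trans ?_)
    refine (Finset.sum_le_sum fun j _ => hrow j).trans_eq ?_
    rw [Finset.sum_const, Finset.card_univ, Fintype.card_fin, nsmul_eq_mul,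
      ENNReal.ofReal_mul (by positivity), ENNReal.ofReal_natCast]
  rw [← compl_compl G, prob_compl_eq_one_sub hGm.compl,
    ENNReal.ofReal_sub _ (by positivity), ENNReal.ofReal_one]
  exact tsub_le_tsub_left hc 1

end Initialization

lemma norm_sub_inner_smul_sq {E : Type*} [NormedAddCommGroup E] [InnerProductSpace ℝ E] {v : E}
    (hv : ‖v‖ = 1) (w : E) : ‖w - inner ℝ v w • v‖ ^ 2 = ‖w‖ ^ 2 - inner ℝ v w ^ 2 := by
  rw [norm_sub_sq_real, inner_smul_right, norm_smul, hv, real_inner_comm v w, Real.norm_eq_abs,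
    mul_one, sq_abs]
  ring

lemma norm_sub_sq_eq_align_orth {E : Type*} [NormedAddCommGroup E] [InnerProductSpace ℝ E] {v : E}
    (hv : ‖v‖ = 1) (w : E) :
    ‖w - v‖ ^ 2 = (inner ℝ v w - 1) ^ 2 + ‖w - inner ℝ v w • v‖ ^ 2 := by
  rw [norm_sub_inner_smul_sq hv, norm_sub_sq_real, hv, real_inner_comm v w]
  ring

/-! ### From the planar recursion to the risk along SGD. -/

section Convergence

variable {n h r : ℕ}

/-- Along mini-batch SGD the coordinates of every hidden unit, relative to its target, evolve
independently of the other units. -/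
lemma isNeuronPath_sgd {η : ℕ → ℝ} {s : ℕ → Sample n} {Wstar W₀ : Params h r}
    (hv : ∀ j, ‖Wstar j‖ = 1) (hy : ∀ j, 0 < ‖W₀ j - inner ℝ (Wstar j) (W₀ j) • Wstar j‖)
    (hγ : ∀ t, 0 ≤ η t * aggScale (s t).batch (s t).nbrs ∧
      η t * aggScale (s t).batch (s t).nbrs ≤ 1) (j : Fin h) :
    IsNeuronPath (fun t => η t * aggScale (s t).batch (s t).nbrs)
      (fun t => inner ℝ (Wstar j) (sgd η s Wstar W₀ t j))
      (fun t => ‖sgd η s Wstar W₀ t j -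
        inner ℝ (Wstar j) (sgd η s Wstar W₀ t j) • Wstar j‖) := by
  have hpi := Real.pi_pos
  -- Positivity is propagated for all units at once, since each step's gradient formula needs it for
  -- all of them.
  have hpos : ∀ t j, 0 < ‖sgd η s Wstar W₀ t j -
      inner ℝ (Wstar j) (sgd η s Wstar W₀ t j) • Wstar j‖ := by
    intro t
    induction t with
    | zero => exact hy
    | succ t ih =>
      intro j
      rw [sgd_succ_apply hv ih rfl j rfl rfl, norm_step (hv j) (hγ t).1 (hγ t).2 (by positivity)]
      refine mul_pos ?_ (ih j)
      have hd : 0 < 1 / (Real.pi * (1 + (inner ℝ (Wstar j) (sgd η s Wstar W₀ t j) /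
          ‖sgd η s Wstar W₀ t j - inner ℝ (Wstar j) (sgd η s Wstar W₀ t j) • Wstar j‖) ^ 2)) *
          ‖sgd η s Wstar W₀ t j -
            inner ℝ (Wstar j) (sgd η s Wstar W₀ t j) • Wstar j‖⁻¹ :=
        mul_pos (by positivity) (inv_pos.2 (ih j))
      -- The factor `1 - γ + γ d` is positive even for `γ = 1`, through `γ d`; for `γ = 0` it is 1.
      rcases (hγ t).1.eq_or_lt with h0 | h0
      · rw [← h0]; norm_num
      · linarith [mul_pos h0 hd, (hγ t).2]
  refine ⟨fun t => hpos t j, fun t => ?_, fun t => ?_⟩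
  · rw [sgd_succ_apply hv (hpos t) rfl j rfl rfl, inner_step (hv j)]
  · rw [sgd_succ_apply hv (hpos t) rfl j rfl rfl,
      norm_step (hv j) (hγ t).1 (hγ t).2 (by positivity)]

lemma not_mem_nbrs_of_mem_samples {G : SimpleGraph (Fin n)} {train : Finset (Fin n)} {b β : ℕ}
    {s : Sample n} (hs : s ∈ samples G train b β) (i : Fin n) : i ∉ s.nbrs i := fun hi =>
  G.loopless.irrefl i ((hs.2.2 i).1 hi)

/-- Since `aggScale ≤ 1` for every target set, the same estimate serves the training loss and the
batch loss. -/
lemma expectedRisk_le_of_neuron_dist {S : Finset (Fin n)} {N : Fin n → Finset (Fin n)}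
    (hN : ∀ i, i ∉ N i) {Wstar W : Params h r} {d : ℝ} (hW : ∀ j, ‖W j - Wstar j‖ ^ 2 ≤ d) :
    expectedRisk S N Wstar W ≤ h * d := by
  have h1 : ∑ j, neuronLoss (Wstar j) (W j) ≤ h * d := by
    simpa using Finset.sum_le_sum fun j (_ : j ∈ Finset.univ) =>
      (neuronLoss_le (Wstar j) (W j)).trans (hW j)
  have h2 : 0 ≤ ∑ j, neuronLoss (Wstar j) (W j) :=
    Finset.sum_nonneg fun j _ => integral_nonneg fun z => by positivity
  rw [expectedRisk_eq]
  exact (mul_le_of_le_one_left h2 (aggScale_le_one S hN)).trans h1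

/-- The `β³` in the lower learning rate absorbs `aggScale ≥ 1/(β+1)² ≥ 1/(4β²)`; the upper bound
needs only `aggScale ≤ 1` and `b ≤ n_train`. -/
lemma effective_step_bounds {G : SimpleGraph (Fin n)} {train : Finset (Fin n)} {b β : ℕ}
    (hb : 0 < b) (hbn : b ≤ train.card) (hβ : 1 ≤ β) {c : ℝ} (hc : 0 < c) {η : ℝ}
    (hη1 : c * (β : ℝ) ^ 3 / (train.card * (b : ℝ) ^ 2) ≤ η)
    (hη2 : η ≤ b / (6 * Real.pi * β * train.card))
    {s : Sample n} (hs : s ∈ samples G train b β) :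
    c * β / (4 * train.card * (b : ℝ) ^ 2) ≤ η * aggScale s.batch s.nbrs ∧
      η * aggScale s.batch s.nbrs ≤ 1 := by
  have hpi := Real.pi_gt_three
  have hb' : (0 : ℝ) < b := by exact_mod_cast hb
  have hbn' : (b : ℝ) ≤ train.card := by exact_mod_cast hbn
  have hβ' : (1 : ℝ) ≤ β := by exact_mod_cast hβ
  have hn : (0 : ℝ) < train.card := by linarith
  have hN := not_mem_nbrs_of_mem_samples hs
  have hne : s.batch.Nonempty := Finset.card_pos.1 (hs.2.1 ▸ hb)
  have hlow := le_aggScale hne hN (β := β) fun i => (hs.2.2 i).2.le.trans (min_le_left _ _)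
  have hη0 : 0 ≤ η := le_trans (by positivity) hη1
  constructor
  · refine le_trans ?_ (mul_le_mul hη1 hlow (by positivity) hη0)
    rw [mul_one_div, div_div, div_le_div_iff₀ (by positivity) (by positivity)]
    have : ((β : ℝ) + 1) ^ 2 ≤ 4 * (β : ℝ) ^ 2 := by nlinarith
    calc c * β * (train.card * (b : ℝ) ^ 2 * ((β : ℝ) + 1) ^ 2)
        ≤ c * β * (train.card * (b : ℝ) ^ 2 * (4 * (β : ℝ) ^ 2)) := by gcongr
      _ = c * (β : ℝ) ^ 3 * (4 * train.card * (b : ℝ) ^ 2) := by ring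
  · refine (mul_le_of_le_one_right hη0 (aggScale_le_one _ hN)).trans (hη2.trans ?_)
    refine div_le_one_of_le₀ (hbn'.trans ?_) (by positivity)
    refine le_mul_of_one_le_left hn.le ?_
    nlinarith

/-- Convergence of mini-batch SGD for all admissible samples, if no hidden unit starts too long
or too close to the line through its target. -/
lemma expectedRisk_sgd_le {G : SimpleGraph (Fin n)} {train : Finset (Fin n)} {b β : ℕ}
    {η : ℕ → ℝ} {s : ℕ → Sample n} (hs : ∀ t, s t ∈ samples G train b β)
    {Wstar W₀ : Params h r} (hv : ∀ j, ‖Wstar j‖ = 1) {g : ℝ} (hg : 0 < g)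
    (hγ : ∀ t, g ≤ η t * aggScale (s t).batch (s t).nbrs ∧
      η t * aggScale (s t).batch (s t).nbrs ≤ 1)
    {R ρ e : ℝ} (hR : 1 ≤ R) (hρ : 0 < ρ)
    (hW₀ : ∀ j, ‖W₀ j‖ ≤ R ∧ ρ ≤ ‖W₀ j - inner ℝ (Wstar j) (W₀ j) • Wstar j‖)
    {N : ℕ} (hN1 : (1 + R) * Real.exp (-(g * N)) ≤ ρ ^ 3 / (2 * Real.pi * R ^ 3))
    (hN2 : Real.exp (-(g * N)) ≤ 1 / 2)
    (hN3 : 10 * R * Real.exp (-(g / 10 * N)) ≤ e) {T : ℕ} (hT : 3 * N ≤ T)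
    (S : Finset (Fin n)) :
    expectedRisk S (s T).nbrs Wstar (sgd η s Wstar W₀ T) ≤ h * e ^ 2 := by
  refine expectedRisk_le_of_neuron_dist (not_mem_nbrs_of_mem_samples (hs T)) fun j => ?_
  have hp := isNeuronPath_sgd hv (fun j => hρ.trans_le (hW₀ j).2)
    (fun t => ⟨hg.le.trans (hγ t).1, (hγ t).2⟩) j
  rw [norm_sub_sq_eq_align_orth (hv j)]
  refine hp.dist_sq_le hg hγ hR hρ ?_ (hW₀ j).2 hN1 hN2 hN3 hT
  simp only [sgd]
  rw [norm_sub_inner_smul_sq (hv j), add_sub_cancel]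
  have := (hW₀ j).1
  gcongr

end Convergence

/-! ### Choice of constants, failure probability and number of steps. -/

/-- The number of steps that `IsNeuronPath.dist_sq_le` needs for the initialization scales of
`le_initLaw_generic` is logarithmic in `h² / ε`. -/
lemma exp_neg_le_of_log_steps {Rc ρc ε : ℝ} (hRc : 1 ≤ Rc) (hρc : 0 < ρc) {h : ℕ} (hh : 2 ≤ h)
    (hε : ε ∈ Set.Ioo (0 : ℝ) 1) {τ : ℝ}
    (hτ : 10 * (Real.log (2 + 10 * Rc + 4 * Real.pi * Rc ^ 4 / ρc ^ 3) + 17) *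
      Real.log ((h : ℝ) ^ 2 / ε) ≤ τ) :
    (1 + Rc * (h : ℝ) ^ 2) * Real.exp (-τ) ≤
        (ρc / (h : ℝ) ^ 3) ^ 3 / (2 * Real.pi * (Rc * (h : ℝ) ^ 2) ^ 3) ∧
      Real.exp (-τ) ≤ 1 / 2 ∧
      10 * (Rc * (h : ℝ) ^ 2) * Real.exp (-(τ / 10)) ≤ ε / h := by
  obtain ⟨hε0, hε1⟩ := hε
  have hpi := Real.pi_pos
  have hh' : (2 : ℝ) ≤ h := by exact_mod_cast hh
  set M := 2 + 10 * Rc + 4 * Real.pi * Rc ^ 4 / ρc ^ 3 with hM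
  set q := (h : ℝ) ^ 2 / ε with hq
  have hQ : 0 < 4 * Real.pi * Rc ^ 4 / ρc ^ 3 := by positivity
  have hM1 : 1 ≤ M := by linarith
  have hqh2 : (h : ℝ) ^ 2 ≤ q := le_div_self (by positivity) hε0 hε1.le
  have hqh : (h : ℝ) ≤ q := le_trans (by nlinarith) hqh2
  have hq4 : 4 ≤ q := le_trans (by nlinarith) hqh2
  have hlogq : 1 ≤ Real.log q := by
    rw [Real.le_log_iff_exp_le (by linarith)]
    linarith [Real.exp_one_lt_d9]
  have hlogM : 0 ≤ Real.log M := Real.log_nonneg hM1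
  have hτ0 : 0 ≤ τ := le_trans (by positivity) hτ
  -- With `R = Rc h²` and `ρ = ρc / h³`, the worst requirement involves `R⁴ / ρ³`, of order
  -- `h^(8+9)`; hence the exponent 17. The summands of `M` serve the three claims, and `τ / 10`
  -- matches the contraction rate `g / 10`.
  have hE : M * q ^ 17 ≤ Real.exp (τ / 10) := by
    have h1 : M * q ^ 17 = Real.exp (Real.log M + 17 * Real.log q) := by
      rw [Real.exp_add, Real.exp_log (by linarith), mul_comm (17 : ℝ), Real.exp_mul,
        Real.exp_log (by linarith)]
      norm_cast
    rw [h1, Real.exp_le_exp]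
    nlinarith
  have hexp10 : Real.exp (-(τ / 10)) ≤ 1 / (M * q ^ 17) := by
    rw [Real.exp_neg, ← one_div]
    exact one_div_le_one_div_of_le (by positivity) hE
  have hexp : Real.exp (-τ) ≤ 1 / (M * q ^ 17) :=
    (Real.exp_le_exp.2 (by linarith)).trans hexp10
  have hq17 : 1 ≤ q ^ 17 := one_le_pow₀ (by linarith)
  refine ⟨?_, ?_, ?_⟩
  · have hR1 : 1 ≤ Rc * (h : ℝ) ^ 2 := by nlinarith
    calc (1 + Rc * (h : ℝ) ^ 2) * Real.exp (-τ)
        ≤ (2 * (Rc * (h : ℝ) ^ 2)) * (1 / (4 * Real.pi * Rc ^ 4 / ρc ^ 3 * (h : ℝ) ^ 17)) := by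
          refine mul_le_mul (by linarith) (hexp.trans ?_) (Real.exp_pos _).le (by positivity)
          refine one_div_le_one_div_of_le (by positivity) ?_
          gcongr
          linarith
      _ = _ := by
          field_simp
          ring
  · refine hexp.trans (one_div_le_one_div_of_le (by norm_num) ?_)
    nlinarith
  · calc 10 * (Rc * (h : ℝ) ^ 2) * Real.exp (-(τ / 10))
        ≤ 10 * (Rc * (h : ℝ) ^ 2) * (1 / (10 * Rc * q ^ 2)) := by
          refine mul_le_mul_of_nonneg_left (hexp10.trans ?_) (by positivity)
          refine one_div_le_one_div_of_le (by positivity) ?_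
          have : q ^ 2 ≤ q ^ 17 := pow_le_pow_right₀ (by linarith) (by norm_num)
          gcongr
          linarith
      _ = (h : ℝ) ^ 2 / q ^ 2 := by
          field_simp
      _ ≤ ε / h := by
          rw [hq, div_pow, div_div_eq_mul_div, div_le_div_iff₀ (by positivity) (by positivity)]
          have h1 : ε * h ≤ (h : ℝ) ^ 2 := by nlinarith
          calc (h : ℝ) ^ 2 * ε ^ 2 * h = ε * (h : ℝ) ^ 2 * (ε * h) := by ring
            _ ≤ ε * (h : ℝ) ^ 2 * (h : ℝ) ^ 2 := by gcongr
            _ = ε * ((h : ℝ) ^ 2) ^ 2 := by ring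

/-- Each of the two bad events per row has budget `δ / (2h³)`, so the union over `h` rows costs `δ /
h²`. -/
lemma failure_probability_le {r h : ℕ} (hh : 2 ≤ h) {κ δ Rc : ℝ} (hκ : 0 < κ) (hδ0 : 0 < δ)
    (hRc : 1 ≤ Rc) (hRc' : 2 * r * κ ^ 2 / δ ≤ Rc) :
    1 - δ / (h : ℝ) ^ 2 ≤ 1 - h * (r * κ ^ 2 / (Rc * (h : ℝ) ^ 2) ^ 2 +
      2 * (δ * κ / 4 / (h : ℝ) ^ 3) / κ) := by
  have hh' : (2 : ℝ) ≤ h := by exact_mod_cast hh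
  have h1 : (r : ℝ) * κ ^ 2 / (Rc * (h : ℝ) ^ 2) ^ 2 ≤ δ / (2 * (h : ℝ) ^ 3) := by
    rw [div_le_div_iff₀ (by positivity) (by positivity)]
    have h2 : 2 * r * (κ : ℝ) ^ 2 ≤ δ * Rc := (div_le_iff₀' hδ0).1 hRc'
    have h3 : Rc * (h : ℝ) ^ 3 ≤ Rc ^ 2 * (h : ℝ) ^ 4 := by
      have := pow_le_pow_right₀ (show (1 : ℝ) ≤ h by linarith) (show 3 ≤ 4 by norm_num)
      have h5 : Rc ≤ Rc ^ 2 := by nlinarith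
      gcongr
    calc (r : ℝ) * κ ^ 2 * (2 * (h : ℝ) ^ 3) = 2 * r * κ ^ 2 * (h : ℝ) ^ 3 := by ring
      _ ≤ δ * Rc * (h : ℝ) ^ 3 := by gcongr
      _ = δ * (Rc * (h : ℝ) ^ 3) := by ring
      _ ≤ δ * (Rc ^ 2 * (h : ℝ) ^ 4) := by gcongr
      _ = δ * (Rc * (h : ℝ) ^ 2) ^ 2 := by ring
  have h2 : 2 * (δ * κ / 4 / (h : ℝ) ^ 3) / κ = δ / (2 * (h : ℝ) ^ 3) := by
    field_simp
    ring
  have h3 : (h : ℝ) * (δ / (2 * (h : ℝ) ^ 3) + δ / (2 * (h : ℝ) ^ 3)) = δ / (h : ℝ) ^ 2 := by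
    field_simp
    ring
  rw [h2]
  have h4 := mul_le_mul_of_nonneg_left (add_le_add_left h1 (δ / (2 * (h : ℝ) ^ 3)))
    (show (0 : ℝ) ≤ h by linarith)
  linarith

/-- The argument needs only order `n b² β⁻¹ log(h²/ε)` steps; the remaining powers are slack.
Rounding up at most doubles `Λ / g ≥ 1`, and `240 = 3 · 2 · 10 · 4`. -/
lemma three_mul_ceil_le {n b β h N : ℕ} {c K ε Λ g : ℝ} (hn : 0 < n) (hb : 0 < b) (hβ : 0 < β)
    (hc : 0 < c) (hK : 0 ≤ K) (hhε : 1 ≤ (h : ℝ) ^ 2 / ε)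
    (hΛ : Λ = 10 * K * Real.log ((h : ℝ) ^ 2 / ε)) (hg : g = c * β / (4 * n * (b : ℝ) ^ 2))
    (hΛg : 1 ≤ Λ / g) (hN : N = ⌈Λ / g⌉₊) :
    ((3 * N : ℕ) : ℝ) ≤ 240 * K / c * (n * (h : ℝ) ^ 2 * (b : ℝ) ^ (5 / 2 : ℝ) *
      (β : ℝ) ^ (-(1 / 2) : ℝ) * ε⁻¹ * Real.log ((h : ℝ) ^ 2 / ε)) := by
  have hb' : (1 : ℝ) ≤ b := by exact_mod_cast hb
  have hβ' : (1 : ℝ) ≤ β := by exact_mod_cast hβ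
  have hn' : (0 : ℝ) < n := by exact_mod_cast hn
  have hlog : 0 ≤ Real.log ((h : ℝ) ^ 2 / ε) := Real.log_nonneg hhε
  have hN' : (N : ℝ) ≤ 2 * (Λ / g) := by
    have h1 := (Nat.ceil_lt_add_one (show 0 ≤ Λ / g by rw [hΛ, hg]; positivity)).le
    have h2 : 1 ≤ Λ / g := hΛg
    rw [hN]
    linarith
  have hbpow : (b : ℝ) ^ 2 ≤ (b : ℝ) ^ (5 / 2 : ℝ) := by
    rw [← Real.rpow_natCast]
    exact Real.rpow_le_rpow_of_exponent_le hb' (by norm_num)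
  have hβpow : (β : ℝ)⁻¹ ≤ (β : ℝ) ^ (-(1 / 2) : ℝ) := by
    rw [← Real.rpow_neg_one]
    exact Real.rpow_le_rpow_of_exponent_le hβ' (by norm_num)
  have hhε' : 1 ≤ (h : ℝ) ^ 2 * ε⁻¹ := by rwa [← div_eq_mul_inv]
  calc ((3 * N : ℕ) : ℝ) ≤ 6 * (Λ / g) := by push_cast; linarith
    _ = 240 * K / c * (n * ((b : ℝ) ^ 2 * (β : ℝ)⁻¹ * 1) *
        Real.log ((h : ℝ) ^ 2 / ε)) := by
        rw [hΛ, hg]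
        field_simp
        ring
    _ ≤ 240 * K / c * (n * ((b : ℝ) ^ (5 / 2 : ℝ) * (β : ℝ) ^ (-(1 / 2) : ℝ) *
        ((h : ℝ) ^ 2 * ε⁻¹)) * Real.log ((h : ℝ) ^ 2 / ε)) := by
        gcongr
    _ = _ := by ring

end MiniBatchGNN

end

/-! ### The convergence theorem. -/

open MiniBatchGNN in
theorem theorem1
    (r : ℕ) (hr : 2 ≤ r) (κ : ℝ≥0) (hκ : 0 < κ)
    (C₁ C₂ : ℝ) (hC₁ : C₁ ∈ Set.Ioo (0 : ℝ) 1) (hC₂ : C₂ ∈ Set.Ioo (0 : ℝ) 1)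
    (c : ℝ) (hc : c ∈ Set.Ioc (0 : ℝ) (1 / (6 * Real.pi)))
    (δ : ℝ) (hδ : δ ∈ Set.Ioo (0 : ℝ) 1) :
    ∃ C : ℝ, 0 < C ∧
      ∀ (n : ℕ) (G : SimpleGraph (Fin n)) (train : Finset (Fin n)) (h b β : ℕ),
        2 ≤ h → b ≤ train.card →
        C₁ ≤ (β : ℝ) → (β : ℝ) ≤ C₂ * (b : ℝ) ^ (3 / 4 : ℝ) →
      ∀ Wstar : Params h r, (∀ j, ‖Wstar j‖ = 1) →
      ∀ η : ℕ → ℝ,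
        (∀ t, c * (β : ℝ) ^ 3 / (train.card * (b : ℝ) ^ 2) ≤ η t ∧
          η t ≤ b / (6 * Real.pi * β * train.card)) →
      ∀ ε ∈ Set.Ioo (0 : ℝ) 1,
      ∀ (Ω : Type*) [MeasurableSpace Ω] (P : Measure Ω) [IsProbabilityMeasure P]
        (W₀ : Ω → Params h r) (S : ℕ → Ω → Sample n),
        HasLaw W₀ (initLaw h r κ) P →
        (∀ t, HasLaw (S t) (uniformOn (samples G train b β)) P) →
        iIndepFun S P →
        IndepFun W₀ (fun ω t => S t ω) P →
      ∃ T₀ : ℕ,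
        (T₀ : ℝ) ≤ C * (train.card * (h : ℝ) ^ 2 * (b : ℝ) ^ (5 / 2 : ℝ) *
          (β : ℝ) ^ (-(1 / 2) : ℝ) * ε⁻¹ * Real.log ((h : ℝ) ^ 2 / ε)) ∧
        ENNReal.ofReal (1 - δ / (h : ℝ) ^ 2) ≤
          P {ω | ∀ T ≥ T₀,
            let W := sgd η (fun t => S t ω) Wstar (W₀ ω) T
            expectedRisk train (S T ω).nbrs Wstar W ≤ ε ∧
            expectedRisk (S T ω).batch (S T ω).nbrs Wstar W ≤ ε} := by
  obtain ⟨hc0, -⟩ := hc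
  obtain ⟨hδ0, -⟩ := hδ
  have hκ' : (0 : ℝ) < κ := hκ
  have hpi := Real.pi_pos
  set Rc : ℝ := 1 + 2 * r * κ ^ 2 / δ with hRcdef
  have hRc : 1 ≤ Rc := le_add_of_nonneg_right (by positivity)
  set ρc : ℝ := δ * κ / 4 with hρcdef
  have hρc : 0 < ρc := by positivity
  set K := Real.log (2 + 10 * Rc + 4 * Real.pi * Rc ^ 4 / ρc ^ 3) + 17 with hK
  have hK17 : 17 ≤ K := by
    have : 0 < 4 * Real.pi * Rc ^ 4 / ρc ^ 3 := by positivity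
    exact le_add_of_nonneg_left (Real.log_nonneg (by linarith))
  refine ⟨240 * K / c, by positivity, ?_⟩
  intro n G train h b β hh hbn hβ1 hβ2 Wstar hv η hη ε hε Ω _ P _ W₀ S hW₀ hS _ _
  have hε0 := hε.1
  have hβ0 : 1 ≤ β := by
    have : (0 : ℝ) < β := hC₁.1.trans_le hβ1
    exact_mod_cast this
  have hβ' : (1 : ℝ) ≤ β := by exact_mod_cast hβ0
  -- For `b = 0` the fan-out condition would force `β ≤ 0`.
  have hb0 : 0 < b := by
    rcases Nat.eq_zero_or_pos b with rfl | hb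
    · rw [Nat.cast_zero, Real.zero_rpow (by norm_num), mul_zero] at hβ2
      linarith
    · exact hb
  have hb' : (1 : ℝ) ≤ b := by exact_mod_cast hb0
  have hn' : (1 : ℝ) ≤ train.card := hb'.trans (by exact_mod_cast hbn)
  have hh' : (2 : ℝ) ≤ h := by exact_mod_cast hh
  have hq4 : 4 ≤ (h : ℝ) ^ 2 / ε :=
    le_trans (by nlinarith) (le_div_self (by positivity) hε0 hε.2.le)
  have hlogq : 1 ≤ Real.log ((h : ℝ) ^ 2 / ε) := by
    rw [Real.le_log_iff_exp_le (by linarith)]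
    linarith [Real.exp_one_lt_d9]
  set Λ := 10 * K * Real.log ((h : ℝ) ^ 2 / ε) with hΛ
  have hΛ1 : 1 ≤ Λ := by nlinarith
  set g := c * β / (4 * train.card * (b : ℝ) ^ 2) with hgdef
  have hg : 0 < g := by positivity
  have hsteps : ∀ ω, (∀ t, S t ω ∈ samples G train b β) → ∀ t,
      g ≤ η t * aggScale (S t ω).batch (S t ω).nbrs ∧
        η t * aggScale (S t ω).batch (S t ω).nbrs ≤ 1 := fun ω hω t =>
    effective_step_bounds hb0 hbn hβ0 hc0 (hη t).1 (hη t).2 (hω t)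
  -- Only almost sure admissibility of the samples is needed, since the convergence estimate is
  -- pathwise.
  have hae : ∀ᵐ ω ∂P, ∀ t, S t ω ∈ samples G train b β := by
    rw [ae_all_iff]
    intro t
    exact ((hS t).ae_iff (p := fun s => s ∈ samples G train b β) measurable_from_top).2
      (ae_cond_mem MeasurableSpace.measurableSet_top)
  -- An almost sure event is nonempty, and along any admissible path `g` lies below an effective
  -- step that is at most 1.
  have hg1 : g ≤ 1 := by
    obtain ⟨ω, hω⟩ := hae.exists
    exact (hsteps ω hω 0).1.trans (hsteps ω hω 0).2
  set N := ⌈Λ / g⌉₊ with hN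
  have hgN : Λ ≤ g * N := by
    rw [← div_le_iff₀' hg]
    exact Nat.le_ceil _
  obtain ⟨hN1, hN2, hN3⟩ := exp_neg_le_of_log_steps hRc hρc hh hε hgN
  refine ⟨3 * N, ?_, ?_⟩
  · have hΛg : 1 ≤ Λ / g := (one_le_div hg).2 (hg1.trans hΛ1)
    exact three_mul_ceil_le (by omega) hb0 hβ0 hc0 (by linarith) (by linarith) hΛ hgdef hΛg hN
  · have hR1 : 1 ≤ Rc * (h : ℝ) ^ 2 := by nlinarith
    have hinit := le_initLaw_generic hr hκ Wstar (R := Rc * (h : ℝ) ^ 2)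
      (ρ := ρc / (h : ℝ) ^ 3) (by positivity) (by positivity)
    have hprob := failure_probability_le (r := r) hh hκ' hδ0 hRc
      (le_add_of_nonneg_left zero_le_one)
    refine (ENNReal.ofReal_le_ofReal hprob).trans (hinit.trans ?_)
    rw [← hW₀.measure_eq (measurableSet_generic Wstar _ _)]
    refine measure_mono_ae ?_
    filter_upwards [hae] with ω hω hgood T hT
    have hfin : ∀ S' : Finset (Fin n), expectedRisk S' (S T ω).nbrs Wstar
        (sgd η (fun t => S t ω) Wstar (W₀ ω) T) ≤ ε := by
      intro S'
      -- Accuracy `ε / h` per neuron gives total risk at most `h (ε/h)² = ε²/h ≤ ε`.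
      refine (expectedRisk_sgd_le (e := ε / h) hω hv hg (hsteps ω hω) hR1 (by positivity) hgood
        hN1 hN2 ?_ hT S').trans ?_
      · rwa [div_mul_eq_mul_div]
      · rw [div_pow, mul_div_assoc', div_le_iff₀ (by positivity)]
        have h1 : ε ≤ h := by linarith [hε.2]
        calc (h : ℝ) * ε ^ 2 = ε * h * ε := by ring
          _ ≤ ε * h * h := by gcongr
          _ = ε * (h : ℝ) ^ 2 := by ring
    exact ⟨hfin _, hfin _⟩
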